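/- **Queue with general increments.** Let $N\ge 0$, let $(p_k^0)_{0\le k\le N}$ and $(p_k^1)_{-1\le k\le N}$ be probability vectors, and consider the discrete-time Markov chain on $\{0,1,2,\dots\}$ (the queue size $Q$) whose increment in a timeslot equals $k$ with probability $p_k^0$ if the queue is empty and with probability $p_k^1$ otherwise. Put $\lambda_r^0=\sum_{k=1}^N k\,p_k^0$. In the convention in which the entry $(i,j)$ is the probability of moving from $j$ to $i$, the transition matrix is column-stochastic and lower Hessenberg (the entry $(i,j)$ vanishes for $j>i+1$). Call the queue stable if $\sum_{k=1}^N k\,p_k^1<p_{-1}^1$; if $\lambda_r^0>0$ and $p_{-1}^1>0$, this holds if and only if the chain has a stationary distribution. If the queue is stable, the chain has exactly one stationary distribution $s=(s_i)_{i\ge0}$, and, with $A(z)=\sum_{i=0}^{N}p_i^0z^{-i}$ and $B(z)=\sum_{i=0}^{N+1}p_{i-1}^1z^{-i}$, $$P(Q=0)=s_0=\frac{1+B'(1)}{1+B'(1)-A'(1)}=\frac{p_{-1}^1-\sum_{i=1}^N i\,p_i^1}{p_{-1}^1-\sum_{i=1}^N i\,p_i^1+\lambda_r^0}.$$ The mean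 queue size $\overline Q=\sum_{i\ge0} i\,s_i$ is finite, the z-transform $S(z)=\sum_{i\ge0}s_iz^{-i}$ is differentiable at $z=1$, and $\overline Q=-S'(1)=-s_0\,K''(1)/L''(1)$, where $L''(1)\ne0$ and $$K(z)=\bigl(-z^{-2}A(z)+z^{-1}A'(z)-B'(z)\bigr)\bigl(z^{-1}-B(z)\bigr)-\bigl(z^{-1}A(z)-B(z)\bigr)\bigl(-z^{-2}-B'(z)\bigr),\qquad L(z)=\bigl(z^{-1}-B(z)\bigr)^2 .$$ Explicitly, $$\overline Q=\frac{\bigl(\sum_{k=1}^N k\,p_k^1-p_{-1}^1\bigr)\sum_{k=1}^N k(k+3)\,p_k^0+\lambda_r^0\bigl(2p_{-1}^1-\sum_{k=1}^N k(k+3)\,p_k^1\bigr)}{2\bigl(\sum_{k=1}^N k\,p_k^1-p_{-1}^1\bigr)\bigl(p_{-1}^1-\sum_{k=1}^N k\,p_k^1+\lambda_r^0\bigr)} .$$ **Relay network.** This applies to the following queue at a relay $R$ serving $N$ symmetric users. In each timeslot each user transmits with probability $q_{tx}$; a transmitting user uses a fully directional (FD) transmission with probability $q_{uf}$ and a broadcast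 (BR) transmission with probability $q_{ub}=1-q_{uf}$; an FD transmission is directed to $R$ with probability $q_{ur}$ and to the access point with probability $q_{um}=1-q_{ur}$; $R$ transmits with probability $q_r$ when its queue is non-empty. All these are numbers in $[0,1]$. For FD and BR interferers, $a$ and $b$ in number, let $P^f_{ur}(a,b)$, $P^b_{ur}(a,b)$ be the success probabilities of an FD, respectively BR, transmission from a user to $R$, $P^b_{ud}(a,b;\rho)$ that of a BR transmission from a user to the access point ($\rho=1$ if $R$ interferes too, $\rho=0$ if not), and $P^f_{rd}(a,b)$ that of a transmission from $R$ to the access point; they are arbitrary in $[0,1]$. Write $\overline x=1-x$. For $0\le j\le i\le m\le N$ put $$w_{mij}=\tbinom Nm q_{tx}^m\overline q_{tx}^{\,N-m}\tbinom mi q_{uf}^iq_{ub}^{m-i}\tbinom ij q_{ur}^jq_{um}^{i-j},\qquad F=P^f_{ur}(j-1,m-i),$$ $$G_\rho=P^b_{ur}(j,m-i-1)\,\bigl(1-P^b_{ud}(i-j,m-i-1;\rho)\bigr),\qquad D=P^f_{rd}(i-j,m-i),$$ (where $F$ is needed only for $j\ge1$ and $G_\rho$ only for $m>i$), and $$g_\rho(k)=\sum_{k_f=\max(0,k+i-m)}^{\min(j,k)}\tbinom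 j{k_f}F^{k_f}\overline F^{\,j-k_f}\tbinom{m-i}{k-k_f}G_\rho^{k-k_f}\overline G_\rho^{\,m-i-k+k_f}.$$ Let $\Sigma_k$ denote the sum over $k\le m\le N$, $0\le i\le m$, $\max(0,k+i-m)\le j\le i$, and set $$r_k^0=\Sigma_k\,w_{mij}\,g_0(k),\qquad r_k^1=\overline q_r r_k^0+q_r\Sigma_k\,w_{mij}\,g_1(k),\qquad \lambda_r^0=\sum_{k=1}^N k\,r_k^0,\quad \lambda_r^1=\sum_{k=1}^N k\,r_k^1,\quad \mu_r=q_r\Sigma_0\,w_{mij}D,$$ $$p_k^0=r_k^0,\qquad p_{-1}^1=q_r\Sigma_0\,w_{mij}\,D\,\overline F^{\,j}\,\overline G_1^{\,m-i},$$ $$p_k^1=\overline q_r r_k^0+q_r\Sigma_k\,w_{mij}\,g_1(k)\,\overline D+q_r\Sigma_{k+1}\,w_{mij}\,g_1(k+1)\,D\quad(1\le k\le N),\qquad p_0^1=1-p_{-1}^1-\sum_{k=1}^N p_k^1 .$$ Then $(p_k^0)_{0\le k\le N}$ and $(p_k^1)_{-1\le k\le N}$ are probability vectors, the two definitions of $\lambda_r^0$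 agree, and the queue is stable in the above sense if and only if $\lambda_r^1<\mu_r$. -/

import Mathlib

/-- Increment laws of the queue: `p0` is a probability vector on the increments `0, …, N` (used when
the queue is empty), `p1` is a probability vector on the increments `-1, 0, …, N` (used otherwise).
Values of `p0`, `p1` at other arguments are never used. -/
structure IsIncrementLaw (N : ℕ) (p0 : ℕ → ℝ) (p1 : ℤ → ℝ) : Prop where
  p0_nonneg : ∀ k ≤ N, 0 ≤ p0 k
  p0_sum : ∑ k ∈ Finset.range (N + 1), p0 k = 1
  p1_nonneg : ∀ k ∈ Finset.Icc (-1 : ℤ) N, 0 ≤ p1 k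
  p1_sum : ∑ k ∈ Finset.Icc (-1 : ℤ) N, p1 k = 1

/-- Transition matrix of the queue, in the column convention: the entry `(i, j)` is the probability
that the queue size moves from `j` to `i` in one timeslot. -/
def queueMatrix (N : ℕ) (p0 : ℕ → ℝ) (p1 : ℤ → ℝ) : Matrix ℕ ℕ ℝ := fun i j =>
  if j = 0 then (if i ≤ N then p0 i else 0)
  else if j ≤ i + 1 ∧ i ≤ j + N then p1 ((i : ℤ) - (j : ℤ)) else 0

/-- `s` is a stationary (steady-state) distribution of the column-stochastic matrix `P`:
a probability vector on `ℕ` with `s = P s`. -/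
structure IsStationaryDist (P : Matrix ℕ ℕ ℝ) (s : ℕ → ℝ) : Prop where
  nonneg : ∀ i, 0 ≤ s i
  hasSum_one : HasSum s 1
  invariant : ∀ i, HasSum (fun j => P i j * s j) (s i)

/-- Mean number of arrivals per timeslot when the queue is empty, `λ_r^0 = ∑_{k=1}^N k p_k^0`. -/
def emptyArrivalRate (N : ℕ) (p0 : ℕ → ℝ) : ℝ := ∑ k ∈ Finset.Icc 1 N, (k : ℝ) * p0 k

/-- `∑_{k=1}^N k p_k^1`, the mean upward increment when the queue is not empty. -/
def meanUp (N : ℕ) (p1 : ℤ → ℝ) : ℝ := ∑ k ∈ Finset.Icc 1 N, (k : ℝ) * p1 (k : ℤ)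

/-- Stability of the queue (negative mean increment when the queue is not empty). -/
def QueueStable (N : ℕ) (p1 : ℤ → ℝ) : Prop := meanUp N p1 < p1 (-1)

/-- `A(z) = ∑_{i=0}^N a_i z^{-i}` with `a_i = p_i^0`. -/
noncomputable def transA (N : ℕ) (p0 : ℕ → ℝ) (z : ℝ) : ℝ :=
  ∑ i ∈ Finset.range (N + 1), p0 i * z ^ (-(i : ℤ))

/-- `B(z) = ∑_{i=0}^{N+1} b_i z^{-i}` with `b_i = p_{i-1}^1`. -/
noncomputable def transB (N : ℕ) (p1 : ℤ → ℝ) (z : ℝ) : ℝ :=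
  ∑ i ∈ Finset.range (N + 2), p1 ((i : ℤ) - 1) * z ^ (-(i : ℤ))

/-- The z-transform `S(z) = ∑_{i ≥ 0} s_i z^{-i}`. -/
noncomputable def transS (s : ℕ → ℝ) (z : ℝ) : ℝ := ∑' i : ℕ, s i * z ^ (-(i : ℤ))

/-- Numerator of `S' / s_0`, where `S = s_0 (z^{-1} A - B) / (z^{-1} - B)`. -/
noncomputable def transK (N : ℕ) (p0 : ℕ → ℝ) (p1 : ℤ → ℝ) (z : ℝ) : ℝ :=
  (-(z ^ (-2 : ℤ)) * transA N p0 z + z⁻¹ * deriv (transA N p0) z - deriv (transB N p1) z)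
      * (z⁻¹ - transB N p1 z)
    - (z⁻¹ * transA N p0 z - transB N p1 z) * (-(z ^ (-2 : ℤ)) - deriv (transB N p1) z)

/-- Denominator of `S' / s_0`. -/
noncomputable def transL (N : ℕ) (p1 : ℤ → ℝ) (z : ℝ) : ℝ := (z⁻¹ - transB N p1 z) ^ 2

/-- The parameters of the network with `N` symmetric users (UEs), a relay `R` and an access point.
`Puf a b`, `Pub a b` are the success probabilities of a fully directional (FD), respectively
broadcast (BR), transmission from a UE to `R` in the presence of `a` FD and `b` BR interferers;
`Pud r a b` that of a BR transmission from a UE to the access point with `a` FD and `b` BR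
interfering UEs, where `r` tells whether `R` interferes as well; `Prd a b` that of a transmission
from `R` to the access point. -/
structure RelayNetwork where
  N : ℕ
  /-- transmit probability of the relay -/
  qr : ℝ
  /-- actual transmit probability of a UE -/
  qtx : ℝ
  /-- probability that a transmitting UE uses an FD transmission -/
  quf : ℝ
  /-- probability that an FD transmission is directed to the relay -/
  qur : ℝ
  Puf : ℕ → ℕ → ℝ
  Pub : ℕ → ℕ → ℝ
  Pud : Bool → ℕ → ℕ → ℝ
  Prd : ℕ → ℕ → ℝ
  qr_mem : qr ∈ Set.Icc (0 : ℝ) 1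
  qtx_mem : qtx ∈ Set.Icc (0 : ℝ) 1
  quf_mem : quf ∈ Set.Icc (0 : ℝ) 1
  qur_mem : qur ∈ Set.Icc (0 : ℝ) 1
  Puf_mem : ∀ a b, Puf a b ∈ Set.Icc (0 : ℝ) 1
  Pub_mem : ∀ a b, Pub a b ∈ Set.Icc (0 : ℝ) 1
  Pud_mem : ∀ r a b, Pud r a b ∈ Set.Icc (0 : ℝ) 1
  Prd_mem : ∀ a b, Prd a b ∈ Set.Icc (0 : ℝ) 1

namespace RelayNetwork

/-- Probability that a given set of transmission choices has `m` transmitting UEs, `i` of them with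
FD, and `j` of the latter towards the relay. -/
def weight (net : RelayNetwork) (m i j : ℕ) : ℝ :=
  (net.N.choose m : ℝ) * net.qtx ^ m * (1 - net.qtx) ^ (net.N - m)
    * ((m.choose i : ℝ) * net.quf ^ i * (1 - net.quf) ^ (m - i))
    * ((i.choose j : ℝ) * net.qur ^ j * (1 - net.qur) ^ (i - j))

/-- Probability that an FD packet to the relay is received (the natural subtraction is harmless:
this is only raised to the power `0` when `j = 0`). -/
def fdSucc (net : RelayNetwork) (m i j : ℕ) : ℝ := net.Puf (j - 1) (m - i)

/-- Probability that a BR packet is received by the relay and not by the access point, `r` telling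
whether the relay transmits (only raised to the power `0` when `m = i`). -/
def brSucc (net : RelayNetwork) (r : Bool) (m i j : ℕ) : ℝ :=
  net.Pub j (m - i - 1) * (1 - net.Pud r (i - j) (m - i - 1))

/-- Given `m`, `i`, `j`, the probability that the relay receives exactly `k` packets; `kf` of them
are received by FD transmissions. Here `k + i - m` is `max (0, k + i - m)`. -/
def recvGiven (net : RelayNetwork) (r : Bool) (k m i j : ℕ) : ℝ :=
  ∑ kf ∈ Finset.Icc (k + i - m) (min j k),
    (j.choose kf : ℝ) * net.fdSucc m i j ^ kf * (1 - net.fdSucc m i j) ^ (j - kf)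
      * (((m - i).choose (k - kf) : ℝ) * net.brSucc r m i j ^ (k - kf)
        * (1 - net.brSucc r m i j) ^ (m - i - (k - kf)))

/-- `r_k^0`: the relay receives `k` packets when its queue is empty. -/
def r0 (net : RelayNetwork) (k : ℕ) : ℝ :=
  ∑ m ∈ Finset.Icc k net.N, ∑ i ∈ Finset.range (m + 1), ∑ j ∈ Finset.Icc (k + i - m) i,
    net.weight m i j * net.recvGiven false k m i j

/-- `r_k^1`: the relay receives `k` packets when its queue is not empty. -/
def r1 (net : RelayNetwork) (k : ℕ) : ℝ :=
  (1 - net.qr) * net.r0 k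
    + net.qr * ∑ m ∈ Finset.Icc k net.N, ∑ i ∈ Finset.range (m + 1),
        ∑ j ∈ Finset.Icc (k + i - m) i, net.weight m i j * net.recvGiven true k m i j

/-- Arrival rate `λ_r^0` at the relay when its queue is empty. -/
def lam0 (net : RelayNetwork) : ℝ := ∑ k ∈ Finset.Icc 1 net.N, (k : ℝ) * net.r0 k

/-- Arrival rate `λ_r^1` at the relay when its queue is not empty. -/
def lam1 (net : RelayNetwork) : ℝ := ∑ k ∈ Finset.Icc 1 net.N, (k : ℝ) * net.r1 k

/-- Service rate `μ_r` of the relay. -/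
def mu (net : RelayNetwork) : ℝ :=
  net.qr * ∑ m ∈ Finset.range (net.N + 1), ∑ i ∈ Finset.range (m + 1),
    ∑ j ∈ Finset.range (i + 1), net.weight m i j * net.Prd (i - j) (m - i)

/-- `p_k^0` for `0 ≤ k ≤ N`. -/
def p0 (net : RelayNetwork) (k : ℕ) : ℝ := net.r0 k

/-- `p_{-1}^1`: nothing is received and the relay transmits successfully. -/
def p1Down (net : RelayNetwork) : ℝ :=
  net.qr * ∑ m ∈ Finset.range (net.N + 1), ∑ i ∈ Finset.range (m + 1),
    ∑ j ∈ Finset.range (i + 1),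
      net.weight m i j * net.Prd (i - j) (m - i) * (1 - net.fdSucc m i j) ^ j
        * (1 - net.brSucc true m i j) ^ (m - i)

/-- `p_k^1` for `1 ≤ k ≤ N`: either `k` packets are received and the relay does not transmit
successfully, or `k + 1` packets are received and the relay transmits successfully. -/
def p1Up (net : RelayNetwork) (k : ℕ) : ℝ :=
  (1 - net.qr) * net.r0 k
    + net.qr * ∑ m ∈ Finset.Icc k net.N, ∑ i ∈ Finset.range (m + 1),
        ∑ j ∈ Finset.Icc (k + i - m) i,
          net.weight m i j * net.recvGiven true k m i j * (1 - net.Prd (i - j) (m - i))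
    + net.qr * ∑ m ∈ Finset.Icc (k + 1) net.N, ∑ i ∈ Finset.range (m + 1),
        ∑ j ∈ Finset.Icc (k + 1 + i - m) i,
          net.weight m i j * net.recvGiven true (k + 1) m i j * net.Prd (i - j) (m - i)

/-- `p_k^1` for `-1 ≤ k ≤ N`, with `p_0^1 = 1 - p_{-1}^1 - ∑_{k=1}^N p_k^1`. -/
def p1 (net : RelayNetwork) (k : ℤ) : ℝ :=
  if k = -1 then net.p1Down
  else if k = 0 then 1 - net.p1Down - ∑ l ∈ Finset.Icc 1 net.N, net.p1Up l
  else net.p1Up k.toNat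

end RelayNetwork

/-!
The transition matrix moves mass downwards only by one step, so a probability vector `s` is
invariant exactly when the flow across every cut between `i` and `i + 1` balances
(`invariant_iff_cutFlow`). With `α_i = ∑_{k > i} p_k^0` and `β_m = ∑_{k > m} p_k^1` this reads
`p_{-1}^1 s_{i+1} = s_0 α_i + ∑_{j < i} s_{j+1} β_{i-1-j}`, a renewal equation for the shifted
sequence `s_{i+1}`, which determines `s` from `s_0`. Since `∑ α_i = λ_r^0` and `∑ β_m` is the mean
upward increment, summing over `i` gives flow balance (`IsStationaryDist.flow_balance`), hence the
value of `s_0`, uniqueness, and, if `λ_r^0` and `p_{-1}^1` are positive, the impossibility of a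
stationary distribution without stability.
Stability says that the kernel `β / p_{-1}^1` is defective. It remains so with the weights
`r^{m+1}` for some `r > 1`, so the solution of the renewal equation is nonnegative with
`∑ s_i r^i < ∞` (`IsRenewal.summable_mul_pow`), which gives existence and makes the generating
function differentiable at `1`.

The generating function `G(u) = ∑ s_i u^i` satisfies
`p_{-1}^1 (G(u) - s_0) = s_0 ∑ α_i u^{i+1} + (∑ β_m u^{m+1}) (G(u) - s_0)`; differentiating this at
`1` gives the mean (`IsStationaryDist.mean_eq`). The formula with `K` and `L` is compared with this
value by computing both second derivatives: for `f = z^{-1} A - B` and `g = z^{-1} - B`, which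
vanish at `1`, one has `K = f' g - f g'` and `L = g ^ 2`, so that `K''(1) = f'' g' - f' g''` and
`L''(1) = 2 g' ^ 2` there.

For the relay network, every quantity is an expectation over the transmission choices `(m, i, j)`
(`RelayNetwork.choiceMean`): the restrictions in the sums `Σ_k` only discard vanishing terms. Given
the choices, the number of received packets is a sum of two independent binomial variables, so its
law has total mass one, and this number is independent of the success of the relay. A
success lowers the increment by one whatever is received, so the mean increment of the non-empty queue is
`λ_r^1 - μ_r` (`RelayNetwork.sum_mul_p1Up_sub_p1Down`).
-/

/-! ### Tails of the increment laws -/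

/-- The tail `∑_{k > i} f k` of a law `f` on `0, …, N`. -/
def tailSum (N : ℕ) (f : ℕ → ℝ) (i : ℕ) : ℝ := ∑ k ∈ Finset.Ioc i N, f k

theorem tailSum_of_le {N i : ℕ} (f : ℕ → ℝ) (h : N ≤ i) : tailSum N f i = 0 := by
  simp [tailSum, Finset.Ioc_eq_empty_of_le h]

theorem tailSum_nonneg {N : ℕ} {f : ℕ → ℝ} (hf : ∀ k ≤ N, 0 ≤ f k) (i : ℕ) :
    0 ≤ tailSum N f i :=
  Finset.sum_nonneg fun k hk => hf k (Finset.mem_Ioc.1 hk).2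

theorem tailSum_eq_add_tailSum_succ (N : ℕ) (f : ℕ → ℝ) (i : ℕ) :
    tailSum N f i = (if i + 1 ≤ N then f (i + 1) else 0) + tailSum N f (i + 1) := by
  unfold tailSum
  split_ifs with h
  · rw [← Finset.insert_Ioc_add_one_left_eq_Ioc (Nat.lt_of_succ_le h),
      Finset.sum_insert (by simp)]
  · rw [Finset.Ioc_eq_empty_of_le (by omega), Finset.Ioc_eq_empty_of_le (by omega)]
    simp

theorem sum_range_succ_eq_add_tailSum (N : ℕ) (f : ℕ → ℝ) :
    ∑ k ∈ Finset.range (N + 1), f k = f 0 + tailSum N f 0 := by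
  rw [Finset.sum_range_succ', add_comm, tailSum]
  congr 1
  change _ = ∑ k ∈ Finset.Icc 1 N, f k
  rw [← Finset.Ico_add_one_right_eq_Icc, Finset.sum_Ico_eq_sum_range]
  exact Finset.sum_congr (by simp) fun k _ => by rw [add_comm]

/-- Summation by parts for tails. -/
theorem sum_mul_tailSum (N : ℕ) (c f : ℕ → ℝ) :
    ∑ i ∈ Finset.range N, c i * tailSum N f i
      = ∑ k ∈ Finset.Icc 1 N, (∑ i ∈ Finset.range k, c i) * f k := by
  simp only [tailSum, Finset.mul_sum, Finset.sum_mul]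
  refine Finset.sum_comm' fun i k => ?_
  simp only [Finset.mem_range, Finset.mem_Ioc, Finset.mem_Icc]
  omega

theorem sum_tailSum (N : ℕ) (f : ℕ → ℝ) :
    ∑ i ∈ Finset.range N, tailSum N f i = ∑ k ∈ Finset.Icc 1 N, (k : ℝ) * f k := by
  simpa using sum_mul_tailSum N (fun _ => 1) f

theorem sum_succ_mul_tailSum (N : ℕ) (f : ℕ → ℝ) :
    ∑ i ∈ Finset.range N, ((i : ℝ) + 1) * tailSum N f i
      = (∑ k ∈ Finset.Icc 1 N, (k : ℝ) * ((k : ℝ) + 1) * f k) / 2 := by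
  rw [sum_mul_tailSum, Finset.sum_div]
  refine Finset.sum_congr rfl fun k _ => ?_
  have h (k : ℕ) : ∑ i ∈ Finset.range k, ((i : ℝ) + 1) = (k : ℝ) * ((k : ℝ) + 1) / 2 := by
    induction k with
    | zero => simp
    | succ n ih => rw [Finset.sum_range_succ, ih]; push_cast; ring
  rw [h]; ring

theorem sum_Icc_neg_one (N : ℕ) (f : ℤ → ℝ) :
    ∑ k ∈ Finset.Icc (-1 : ℤ) N, f k = ∑ i ∈ Finset.range (N + 2), f ((i : ℤ) - 1) := by
  symm
  refine Finset.sum_bij' (fun i _ => (i : ℤ) - 1) (fun k _ => (k + 1).toNat) ?_ ?_ ?_ ?_ ?_ <;>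
    intro a ha <;> simp only [Finset.mem_range, Finset.mem_Icc] at * <;> first | rfl | omega

theorem sum_Icc_neg_one_eq_add (N : ℕ) (f : ℤ → ℝ) :
    ∑ k ∈ Finset.Icc (-1 : ℤ) N, f k = f (-1) + f 0 + ∑ k ∈ Finset.Icc 1 N, f (k : ℤ) := by
  rw [sum_Icc_neg_one, Finset.sum_range_succ', Finset.sum_range_succ']
  have h : ∑ k ∈ Finset.Icc 1 N, f (k : ℤ) = ∑ k ∈ Finset.range N, f ((k : ℤ) + 1) := by
    rw [← Finset.Ico_add_one_right_eq_Icc, Finset.sum_Ico_eq_sum_range]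
    exact Finset.sum_congr (by simp) fun k _ => by push_cast; rw [add_comm]
  rw [h]
  have h2 : ∀ k : ℕ, ((k + 1 + 1 : ℕ) : ℤ) - 1 = (k : ℤ) + 1 := fun k => by push_cast; ring
  simp only [h2]
  norm_num
  ring

namespace IsIncrementLaw

variable {N : ℕ} {p0 : ℕ → ℝ} {p1 : ℤ → ℝ}

theorem p1_nonneg_natCast (h : IsIncrementLaw N p0 p1) {k : ℕ} (hk : k ≤ N) :
    0 ≤ p1 (k : ℤ) :=
  h.p1_nonneg _ (Finset.mem_Icc.2 ⟨by omega, by omega⟩)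

theorem p0_zero_eq (h : IsIncrementLaw N p0 p1) : p0 0 = 1 - tailSum N p0 0 := by
  have := h.p0_sum
  rw [sum_range_succ_eq_add_tailSum] at this
  linarith

theorem p1_zero_eq (h : IsIncrementLaw N p0 p1) :
    p1 0 = 1 - p1 (-1) - tailSum N (fun k => p1 (k : ℤ)) 0 := by
  have := h.p1_sum
  rw [sum_Icc_neg_one_eq_add] at this
  have h2 : Finset.Ioc 0 N = Finset.Icc 1 N := rfl
  rw [tailSum, h2]
  linarith

theorem tail0_nonneg (h : IsIncrementLaw N p0 p1) (i : ℕ) : 0 ≤ tailSum N p0 i :=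
  tailSum_nonneg h.p0_nonneg i

theorem tail1_nonneg (h : IsIncrementLaw N p0 p1) (i : ℕ) :
    0 ≤ tailSum N (fun k => p1 (k : ℤ)) i :=
  tailSum_nonneg (fun _ hk => h.p1_nonneg_natCast hk) i

end IsIncrementLaw

/-! ### The transition matrix and the flow across cuts -/

section Matrix

variable {N : ℕ} {p0 : ℕ → ℝ} {p1 : ℤ → ℝ}

theorem queueMatrix_zero_right (i : ℕ) :
    queueMatrix N p0 p1 i 0 = if i ≤ N then p0 i else 0 := by simp [queueMatrix]

theorem queueMatrix_succ_right (i j : ℕ) :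
    queueMatrix N p0 p1 i (j + 1)
      = if j ≤ i ∧ i ≤ j + 1 + N then p1 ((i : ℤ) - ((j : ℤ) + 1)) else 0 := by
  simp [queueMatrix]

theorem queueMatrix_nonneg (h : IsIncrementLaw N p0 p1) (i j : ℕ) :
    0 ≤ queueMatrix N p0 p1 i j := by
  cases j with
  | zero =>
    rw [queueMatrix_zero_right]
    split_ifs with hi
    exacts [h.p0_nonneg i hi, le_rfl]
  | succ j =>
    rw [queueMatrix_succ_right]
    split_ifs with hi
    exacts [h.p1_nonneg _ (Finset.mem_Icc.2 ⟨by omega, by omega⟩), le_rfl]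

theorem queueMatrix_eq_zero (i j : ℕ) (hij : i + 1 < j) : queueMatrix N p0 p1 i j = 0 := by
  cases j with
  | zero => omega
  | succ j => rw [queueMatrix_succ_right, if_neg (by omega)]

theorem hasSum_queueMatrix_col (h : IsIncrementLaw N p0 p1) (j : ℕ) :
    HasSum (fun i => queueMatrix N p0 p1 i j) 1 := by
  cases j with
  | zero =>
    simp only [queueMatrix_zero_right]
    convert hasSum_sum_of_ne_finset_zero (L := .unconditional ℕ) (s := Finset.range (N + 1)) ?_
      using 1
    · rw [← h.p0_sum]
      refine Finset.sum_congr rfl fun k hk => ?_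
      rw [if_pos (by simpa [Nat.lt_succ_iff] using hk)]
    · intro b hb
      rw [if_neg (by simpa using hb)]
  | succ j =>
    simp only [queueMatrix_succ_right]
    convert hasSum_sum_of_ne_finset_zero (L := .unconditional ℕ)
      (s := Finset.Ico j (j + (N + 2))) ?_ using 1
    · rw [← h.p1_sum, sum_Icc_neg_one, Finset.sum_Ico_eq_sum_range]
      refine Finset.sum_congr (by congr 1; omega) fun k hk => ?_
      rw [Finset.mem_range] at hk
      rw [if_pos (by omega)]
      congr 1
      push_cast
      ring
    · intro b hb
      rw [Finset.mem_Ico] at hb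
      rw [if_neg (by omega)]

theorem hasSum_queueMatrix_row (s : ℕ → ℝ) (i : ℕ) :
    HasSum (fun j => queueMatrix N p0 p1 i j * s j)
      (∑ j ∈ Finset.range (i + 2), queueMatrix N p0 p1 i j * s j) :=
  hasSum_sum_of_ne_finset_zero fun j hj => by
    rw [Finset.mem_range] at hj
    rw [queueMatrix_eq_zero i j (by omega), zero_mul]

/-- Net downward flow across the cut between `i` and `i + 1`: mass crosses the cut
downwards only from `i + 1`, and upwards from `0` and from `1, …, i` with the tail probabilities of
the increments. -/
def cutFlow (N : ℕ) (p0 : ℕ → ℝ) (p1 : ℤ → ℝ) (s : ℕ → ℝ) (i : ℕ) : ℝ :=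
  p1 (-1) * s (i + 1) - s 0 * tailSum N p0 i
    - ∑ j ∈ Finset.range i, s (j + 1) * tailSum N (fun k => p1 (k : ℤ)) (i - 1 - j)

theorem row_zero_sub_eq_cutFlow (h : IsIncrementLaw N p0 p1) (s : ℕ → ℝ) :
    ∑ j ∈ Finset.range 2, queueMatrix N p0 p1 0 j * s j - s 0 = cutFlow N p0 p1 s 0 := by
  simp [cutFlow, Finset.sum_range_succ, queueMatrix, h.p0_zero_eq]
  ring

theorem row_succ_sub_eq_cutFlow_sub (h : IsIncrementLaw N p0 p1) (s : ℕ → ℝ) (i : ℕ) :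
    ∑ j ∈ Finset.range (i + 3), queueMatrix N p0 p1 (i + 1) j * s j - s (i + 1)
      = cutFlow N p0 p1 s (i + 1) - cutFlow N p0 p1 s i := by
  set β := tailSum N (fun k => p1 (k : ℤ)) with hβ
  have e0 : queueMatrix N p0 p1 (i + 1) 0 = tailSum N p0 i - tailSum N p0 (i + 1) := by
    rw [queueMatrix_zero_right, tailSum_eq_add_tailSum_succ N p0 i]; ring
  have e1 : queueMatrix N p0 p1 (i + 1) (i + 1) = 1 - p1 (-1) - β 0 := by
    rw [queueMatrix_succ_right, if_pos (by omega), ← h.p1_zero_eq]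
    congr 1
    push_cast
    ring
  have e2 : queueMatrix N p0 p1 (i + 1) (i + 1 + 1) = p1 (-1) := by
    rw [queueMatrix_succ_right, if_pos (by omega)]
    congr 1
    push_cast
    ring
  have e3 : ∀ j ∈ Finset.range i, queueMatrix N p0 p1 (i + 1) (j + 1) * s (j + 1)
      = s (j + 1) * β (i - 1 - j) - s (j + 1) * β (i - j) := by
    intro j hj
    rw [Finset.mem_range] at hj
    obtain ⟨m, rfl⟩ : ∃ m, i = j + m + 1 := ⟨i - j - 1, by omega⟩
    have h1 : j + m + 1 - 1 - j = m := by omega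
    have h2 : j + m + 1 - j = m + 1 := by omega
    rw [h1, h2, hβ, tailSum_eq_add_tailSum_succ N _ m, queueMatrix_succ_right]
    have h3 : ((j + m + 1 + 1 : ℕ) : ℤ) - ((j : ℤ) + 1) = ((m + 1 : ℕ) : ℤ) := by
      push_cast; ring
    rw [h3]
    have h4 : (j ≤ j + m + 1 + 1 ∧ j + m + 1 + 1 ≤ j + 1 + N) ↔ m + 1 ≤ N := by omega
    simp only [h4]
    ring
  rw [Finset.sum_range_succ', Finset.sum_range_succ, Finset.sum_range_succ,
    Finset.sum_congr rfl e3, Finset.sum_sub_distrib, e0, e1, e2]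
  simp only [cutFlow, ← hβ]
  rw [Finset.sum_range_succ (n := i)]
  have h1 : i + 1 - 1 = i := rfl
  simp only [h1, Nat.sub_self]
  ring

/-- A vector is invariant iff there is no net flow across any cut. -/
theorem invariant_iff_cutFlow (h : IsIncrementLaw N p0 p1) (s : ℕ → ℝ) :
    (∀ i, HasSum (fun j => queueMatrix N p0 p1 i j * s j) (s i))
      ↔ ∀ i, cutFlow N p0 p1 s i = 0 := by
  have key : ∀ i, HasSum (fun j => queueMatrix N p0 p1 i j * s j) (s i) ↔
      ∑ j ∈ Finset.range (i + 2), queueMatrix N p0 p1 i j * s j - s i = 0 := fun i => by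
    rw [sub_eq_zero]
    exact ⟨fun hs => (hasSum_queueMatrix_row s i).unique hs,
      fun hs => by simpa only [hs] using hasSum_queueMatrix_row (N := N) (p0 := p0) (p1 := p1) s i⟩
  simp only [key]
  refine ⟨fun H i => ?_, fun H i => ?_⟩
  · induction i with
    | zero => rw [← row_zero_sub_eq_cutFlow h]; exact H 0
    | succ i ih =>
      have := row_succ_sub_eq_cutFlow_sub h s i
      rw [H (i + 1), ih] at this
      linarith
  · cases i with
    | zero => rw [row_zero_sub_eq_cutFlow h]; exact H 0
    | succ i => rw [row_succ_sub_eq_cutFlow_sub h, H, H, sub_zero]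

end Matrix

/-! ### A defective renewal equation -/

/-- The renewal equation `p y_i = a_i + ∑_{j < i} y_j b_{i-1-j}`. -/
def IsRenewal (p : ℝ) (a b y : ℕ → ℝ) : Prop :=
  ∀ i, p * y i = a i + ∑ j ∈ Finset.range i, y j * b (i - 1 - j)

/-- The solution of the renewal equation when `p ≠ 0`. -/
noncomputable def renewalSol (p : ℝ) (a b : ℕ → ℝ) (i : ℕ) : ℝ :=
  (a i + ∑ j : Fin i, renewalSol p a b j * b (i - 1 - j)) / p
termination_by i
decreasing_by exact j.2

theorem isRenewal_renewalSol {p : ℝ} (hp : p ≠ 0) (a b : ℕ → ℝ) :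
    IsRenewal p a b (renewalSol p a b) := fun i => by
  rw [renewalSol, mul_div_cancel₀ _ hp, Finset.sum_range]

theorem renewalSol_nonneg {p : ℝ} (hp : 0 ≤ p) {a b : ℕ → ℝ} (ha : ∀ i, 0 ≤ a i)
    (hb : ∀ i, 0 ≤ b i) (i : ℕ) : 0 ≤ renewalSol p a b i := by
  induction i using Nat.strong_induction_on with
  | _ i ih =>
    rw [renewalSol]
    exact div_nonneg (add_nonneg (ha i) (Finset.sum_nonneg fun j _ =>
      mul_nonneg (ih j j.2) (hb _))) hp

theorem IsRenewal.smul {p c : ℝ} {a b y : ℕ → ℝ} (h : IsRenewal p a b y) :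
    IsRenewal p (fun i => c * a i) b (fun i => c * y i) := fun i => by
  have := congrArg (c * ·) (h i)
  simp only [mul_add, Finset.mul_sum] at this
  simp only [mul_assoc] at this ⊢
  rw [← this]
  ring

theorem IsRenewal.unique {p : ℝ} (hp : p ≠ 0) {a b y z : ℕ → ℝ} (hy : IsRenewal p a b y)
    (hz : IsRenewal p a b z) : y = z := by
  funext i
  induction i using Nat.strong_induction_on with
  | _ i ih =>
    refine mul_left_cancel₀ hp ?_
    rw [hy i, hz i]
    congr 1
    exact Finset.sum_congr rfl fun j hj => by rw [ih j (Finset.mem_range.1 hj)]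

/-- A defective kernel stays defective under slightly growing geometric weights. -/
theorem exists_one_lt_sum_mul_pow_lt {N : ℕ} {p : ℝ} {b : ℕ → ℝ}
    (h : ∑ m ∈ Finset.range N, b m < p) :
    ∃ r : ℝ, 1 < r ∧ ∑ m ∈ Finset.range N, b m * r ^ (m + 1) < p := by
  have hc : ContinuousAt (fun r : ℝ => ∑ m ∈ Finset.range N, b m * r ^ (m + 1)) 1 := by
    fun_prop
  have h1 := hc.eventually_lt (continuousAt_const (y := p)) (by simpa using h)
  obtain ⟨r, hr, hr1⟩ := ((h1.filter_mono nhdsWithin_le_nhds).and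
    (self_mem_nhdsWithin (a := (1 : ℝ)) (s := Set.Ioi 1))).exists
  exact ⟨r, hr1, hr⟩

section Renewal

variable {N : ℕ} {p : ℝ} {a b y : ℕ → ℝ}

/-- A nonnegative solution of the renewal equation has geometric tails, at the rate at which
the kernel is still defective: the partial sums `T` of `y_i r^i` satisfy
`p T ≤ ∑ a_i r^i + T ∑ b_m r^{m+1}`. -/
theorem IsRenewal.summable_mul_pow (h : IsRenewal p a b y) (ha : ∀ i, 0 ≤ a i)
    (haN : ∀ i, N ≤ i → a i = 0) (hb : ∀ i, 0 ≤ b i) (hbN : ∀ i, N ≤ i → b i = 0)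
    (hy : ∀ i, 0 ≤ y i) {r : ℝ} (hr : 0 ≤ r)
    (hlt : ∑ m ∈ Finset.range N, b m * r ^ (m + 1) < p) :
    Summable fun i => y i * r ^ i := by
  have sum_le : ∀ f : ℕ → ℝ, (∀ i, 0 ≤ f i) → (∀ i, N ≤ i → f i = 0) → ∀ n,
      ∑ i ∈ Finset.range n, f i ≤ ∑ i ∈ Finset.range N, f i := by
    intro f hf hfN n
    refine (Finset.sum_le_sum_of_subset_of_nonneg
      (Finset.range_mono (le_max_left n N)) fun i _ _ => hf i).trans_eq ?_
    refine (Finset.sum_subset (Finset.range_mono (le_max_right n N)) fun i _ hi => ?_).symm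
    exact hfN i (by simpa using hi)
  set A := ∑ i ∈ Finset.range N, a i * r ^ i
  set β := ∑ m ∈ Finset.range N, b m * r ^ (m + 1)
  refine summable_of_sum_range_le (c := A / (p - β)) (fun i => mul_nonneg (hy i) (by positivity))
    fun n => ?_
  rw [le_div_iff₀ (by linarith)]
  set T := ∑ i ∈ Finset.range n, y i * r ^ i with hT
  have hA : ∑ i ∈ Finset.range n, a i * r ^ i ≤ A :=
    sum_le _ (fun i => mul_nonneg (ha i) (by positivity)) (fun i hi => by simp [haN i hi]) n
  have e1 : p * T = ∑ i ∈ Finset.range n, a i * r ^ i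
      + ∑ i ∈ Finset.range n, ∑ j ∈ Finset.range i, y j * b (i - 1 - j) * r ^ i := by
    rw [hT, Finset.mul_sum, ← Finset.sum_add_distrib]
    refine Finset.sum_congr rfl fun i _ => ?_
    rw [← mul_assoc, h i, add_mul, Finset.sum_mul]
  have e2 : ∑ i ∈ Finset.range n, ∑ j ∈ Finset.range i, y j * b (i - 1 - j) * r ^ i
      = ∑ j ∈ Finset.range n, ∑ i ∈ Finset.Ico (j + 1) n, y j * b (i - 1 - j) * r ^ i :=
    Finset.sum_comm' fun i j => by simp only [Finset.mem_range, Finset.mem_Ico]; omega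
  have e3 : ∑ j ∈ Finset.range n, ∑ i ∈ Finset.Ico (j + 1) n, y j * b (i - 1 - j) * r ^ i
      ≤ T * β := by
    rw [hT, Finset.sum_mul]
    refine Finset.sum_le_sum fun j _ => ?_
    rw [Finset.sum_Ico_eq_sum_range]
    have : ∀ k, y j * b (j + 1 + k - 1 - j) * r ^ (j + 1 + k)
        = y j * r ^ j * (b k * r ^ (k + 1)) := fun k => by
      rw [show j + 1 + k - 1 - j = k by omega]; ring
    simp only [this]
    rw [← Finset.mul_sum]
    refine mul_le_mul_of_nonneg_left ?_ (mul_nonneg (hy j) (by positivity))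
    exact sum_le _ (fun i => mul_nonneg (hb i) (by positivity)) (fun i hi => by simp [hbN i hi]) _
  nlinarith

/-- The renewal equation for generating functions. -/
theorem IsRenewal.mul_tsum_eq (h : IsRenewal p a b y) (haN : ∀ i, N ≤ i → a i = 0)
    (hbN : ∀ i, N ≤ i → b i = 0) {u : ℝ} (hs : Summable fun i => ‖y i * u ^ i‖) :
    p * ∑' i, y i * u ^ i = ∑ i ∈ Finset.range N, a i * u ^ i
      + u * (∑ m ∈ Finset.range N, b m * u ^ m) * ∑' i, y i * u ^ i := by
  have ha : HasSum (fun i => a i * u ^ i) (∑ i ∈ Finset.range N, a i * u ^ i) :=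
    hasSum_sum_of_ne_finset_zero fun i hi => by rw [haN i (by simpa using hi), zero_mul]
  have hb0 : ∀ i ∉ Finset.range N, b i * u ^ i = 0 := fun i hi => by
    rw [hbN i (by simpa using hi), zero_mul]
  have hb : HasSum (fun i => b i * u ^ i) (∑ i ∈ Finset.range N, b i * u ^ i) :=
    hasSum_sum_of_ne_finset_zero hb0
  have hbn : Summable fun i => ‖b i * u ^ i‖ :=
    summable_of_ne_finset_zero (s := Finset.range N) fun i hi => by rw [hb0 i hi, norm_zero]
  have hc := (hasSum_sum_range_mul_of_summable_norm hs hbn).mul_left u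
  rw [hb.tsum_eq] at hc
  have hc' : HasSum (fun i => ∑ j ∈ Finset.range i, y j * b (i - 1 - j) * u ^ i)
      (u * ((∑' i, y i * u ^ i) * ∑ i ∈ Finset.range N, b i * u ^ i)) := by
    rw [← hasSum_nat_add_iff' 1]
    simp only [Finset.range_one, Finset.sum_singleton, Finset.range_zero, Finset.sum_empty,
      sub_zero]
    refine (congrArg (HasSum · _) (funext fun i => ?_)).mpr hc
    rw [Finset.mul_sum]
    refine Finset.sum_congr rfl fun j hj => ?_
    have hj' : j ≤ i := Nat.lt_succ_iff.1 (Finset.mem_range.1 hj)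
    obtain ⟨k, rfl⟩ := Nat.exists_eq_add_of_le hj'
    rw [show j + k + 1 - 1 - j = k by omega, show j + k - j = k by omega]
    ring
  have hsum := ha.add hc'
  have hy : HasSum (fun i => p * (y i * u ^ i)) (p * ∑' i, y i * u ^ i) :=
    hs.of_norm.hasSum.mul_left p
  have e : (fun i => p * (y i * u ^ i))
      = fun i => a i * u ^ i + ∑ j ∈ Finset.range i, y j * b (i - 1 - j) * u ^ i := by
    funext i
    rw [← mul_assoc, h i, add_mul, Finset.sum_mul]
  rw [e] at hy
  rw [hy.unique hsum]
  ring

end Renewal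

/-- A power series with nonnegative coefficients that converges at some `r > 1` has the derivative
`∑ i s_i` at `1`. -/
theorem hasDerivAt_tsum_mul_pow_one {s : ℕ → ℝ} {r : ℝ} (hr : 1 < r)
    (hs : Summable fun i => ‖s i * r ^ i‖) :
    (Summable fun i : ℕ => (i : ℝ) * s i) ∧
      HasDerivAt (fun u : ℝ => ∑' i, s i * u ^ i) (∑' i : ℕ, (i : ℝ) * s i) 1 := by
  obtain ⟨ρ, hρ1, hρr⟩ := exists_between hr
  have hρ0 : 0 < ρ := by linarith
  have hr0 : 0 < r := by linarith
  -- `i (ρ / r)^i` is bounded, so that `i s_i ρ^{i-1}` is dominated by `s_i r^i`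
  obtain ⟨C, hC⟩ : ∃ C : ℝ, ∀ i : ℕ, (i : ℝ) * (ρ / r) ^ i ≤ C := by
    have hq : ‖ρ / r‖ < 1 := by
      rw [Real.norm_of_nonneg (by positivity), div_lt_one hr0]; exact hρr
    have := summable_norm_pow_mul_geometric_of_norm_lt_one 1 hq
    refine ⟨∑' i : ℕ, ‖(i : ℝ) ^ 1 * (ρ / r) ^ i‖, fun i => ?_⟩
    refine le_trans ?_ (this.le_tsum i fun j _ => norm_nonneg _)
    rw [pow_one]
    exact Real.le_norm_self _
  have hdom : Summable fun i : ℕ => ‖s i‖ * ((i : ℝ) * ρ ^ (i - 1)) := by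
    refine Summable.of_nonneg_of_le (fun i => by positivity) (fun i => ?_) (hs.mul_left C)
    have h1 : (i : ℝ) * ρ ^ (i - 1) ≤ i * ρ ^ i := by
      gcongr
      · exact hρ1.le
      · omega
    have h2 : (i : ℝ) * ρ ^ i ≤ C * r ^ i := by
      have := mul_le_mul_of_nonneg_right (hC i) (by positivity : (0 : ℝ) ≤ r ^ i)
      rwa [mul_assoc, ← mul_pow, div_mul_cancel₀ _ hr0.ne'] at this
    rw [norm_mul, Real.norm_of_nonneg (by positivity : (0 : ℝ) ≤ r ^ i)]
    nlinarith [norm_nonneg (s i)]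
  have hone : Summable fun i => s i * (1 : ℝ) ^ i := by
    refine Summable.of_norm_bounded hs fun i => ?_
    rw [norm_mul, norm_mul]
    gcongr
    rw [one_pow, norm_one, Real.norm_of_nonneg (by positivity)]
    exact one_le_pow₀ hr.le
  have hmem : (1 : ℝ) ∈ Metric.ball (0 : ℝ) ρ := by simpa using hρ1
  have hd := hasDerivAt_tsum_of_isPreconnected (y₀ := (1 : ℝ)) (y := 1) (t := Metric.ball 0 ρ)
    (g := fun i u => s i * u ^ i) (g' := fun i u => s i * ((i : ℝ) * u ^ (i - 1))) hdom
    Metric.isOpen_ball (convex_ball _ _).isPreconnected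
    (fun i u _ => (hasDerivAt_pow i u).const_mul (s i))
    (fun i u hu => by
      rw [norm_mul, norm_mul, norm_pow, Real.norm_natCast]
      have : ‖u‖ ≤ ρ := by simpa using (Metric.mem_ball.1 hu).le
      gcongr) hmem hone hmem
  have e : ∀ i : ℕ, s i * ((i : ℝ) * (1 : ℝ) ^ (i - 1)) = i * s i := fun i => by ring
  simp only [e] at hd
  refine ⟨Summable.of_norm_bounded hdom fun i => ?_, hd⟩
  rw [norm_mul, Real.norm_natCast, mul_comm]
  gcongr
  exact le_mul_of_one_le_right (by positivity) (one_le_pow₀ hρ1.le)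

/-! ### Stationary distributions of the queue -/

section Queue

variable {N : ℕ} {p0 : ℕ → ℝ} {p1 : ℤ → ℝ} {s : ℕ → ℝ}

theorem cutFlow_eq_zero_iff_isRenewal (s : ℕ → ℝ) :
    (∀ i, cutFlow N p0 p1 s i = 0) ↔
      IsRenewal (p1 (-1)) (fun i => s 0 * tailSum N p0 i) (tailSum N fun k => p1 (k : ℤ))
        (fun i => s (i + 1)) := by
  refine forall_congr' fun i => ?_
  rw [cutFlow, sub_sub, sub_eq_zero]

theorem sum_tail1_eq_meanUp (N : ℕ) (p1 : ℤ → ℝ) :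
    ∑ m ∈ Finset.range N, tailSum N (fun k => p1 (k : ℤ)) m = meanUp N p1 :=
  sum_tailSum N _

theorem sum_tail0_eq_emptyArrivalRate (N : ℕ) (p0 : ℕ → ℝ) :
    ∑ m ∈ Finset.range N, tailSum N p0 m = emptyArrivalRate N p0 :=
  sum_tailSum N _

theorem IsIncrementLaw.emptyArrivalRate_nonneg (h : IsIncrementLaw N p0 p1) :
    0 ≤ emptyArrivalRate N p0 :=
  Finset.sum_nonneg fun k hk => mul_nonneg (by positivity) (h.p0_nonneg k (Finset.mem_Icc.1 hk).2)

theorem IsIncrementLaw.meanUp_nonneg (h : IsIncrementLaw N p0 p1) : 0 ≤ meanUp N p1 :=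
  Finset.sum_nonneg fun k hk =>
    mul_nonneg (by positivity) (h.p1_nonneg_natCast (Finset.mem_Icc.1 hk).2)

theorem IsStationaryDist.isRenewal (h : IsIncrementLaw N p0 p1)
    (hs : IsStationaryDist (queueMatrix N p0 p1) s) :
    IsRenewal (p1 (-1)) (fun i => s 0 * tailSum N p0 i) (tailSum N fun k => p1 (k : ℤ))
        (fun i => s (i + 1)) :=
  (cutFlow_eq_zero_iff_isRenewal s).1 ((invariant_iff_cutFlow h s).1 hs.invariant)

/-- Total flow balance: summing the cut equations, the mean downward and upward flows of a
stationary distribution agree. -/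
theorem IsStationaryDist.flow_balance (h : IsIncrementLaw N p0 p1)
    (hs : IsStationaryDist (queueMatrix N p0 p1) s) :
    (p1 (-1) - meanUp N p1) * (1 - s 0) = s 0 * emptyArrivalRate N p0 := by
  have hy : HasSum (fun i => s (i + 1)) (1 - s 0) := by
    simpa using (hasSum_nat_add_iff' (f := s) 1).2 hs.hasSum_one
  have := (hs.isRenewal h).mul_tsum_eq (N := N) (u := 1)
    (fun i hi => by rw [tailSum_of_le _ hi, mul_zero]) (fun i hi => tailSum_of_le _ hi)
    (by simpa using hy.summable.norm)
  simp only [one_pow, mul_one, one_mul] at this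
  rw [hy.tsum_eq, ← Finset.mul_sum, sum_tail0_eq_emptyArrivalRate, sum_tail1_eq_meanUp] at this
  linarith

/-- Without stability, flow balance forces `s 0 = 0`, and then all of `s` vanishes. -/
theorem IsStationaryDist.queueStable (h : IsIncrementLaw N p0 p1)
    (hs : IsStationaryDist (queueMatrix N p0 p1) s) (hlam : 0 < emptyArrivalRate N p0)
    (hp : 0 < p1 (-1)) : QueueStable N p1 := by
  have hb := hs.flow_balance h
  have hle : s 0 ≤ 1 := le_hasSum hs.hasSum_one 0 fun j _ => hs.nonneg j
  by_contra hst
  have hd : p1 (-1) - meanUp N p1 ≤ 0 := by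
    unfold QueueStable at hst
    linarith
  have h0 : s 0 = 0 := by nlinarith [hs.nonneg 0, mul_nonneg (hs.nonneg 0) hlam.le]
  have hR := hs.isRenewal h
  have hz : IsRenewal (p1 (-1)) (fun i => s 0 * tailSum N p0 i)
      (tailSum N fun k => p1 (k : ℤ)) (fun _ => 0) := fun i => by simp [h0]
  have hy := hR.unique hp.ne' hz
  have hall : s = fun _ => 0 := by
    funext i
    cases i with
    | zero => exact h0
    | succ i => exact congrFun hy i
  have := hs.hasSum_one
  rw [hall] at this
  exact zero_ne_one (hasSum_zero.unique this)

theorem QueueStable.p1_neg_one_pos (h : IsIncrementLaw N p0 p1) (hst : QueueStable N p1) :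
    0 < p1 (-1) :=
  h.meanUp_nonneg.trans_lt hst

theorem QueueStable.exists_isStationaryDist (h : IsIncrementLaw N p0 p1)
    (hst : QueueStable N p1) : ∃ s, IsStationaryDist (queueMatrix N p0 p1) s := by
  have hp := hst.p1_neg_one_pos h
  set x := renewalSol (p1 (-1)) (tailSum N p0) (tailSum N fun k => p1 (k : ℤ)) with hx
  have hxR : IsRenewal (p1 (-1)) (tailSum N p0) (tailSum N fun k => p1 (k : ℤ)) x :=
    isRenewal_renewalSol hp.ne' _ _
  have hx0 : ∀ i, 0 ≤ x i := renewalSol_nonneg hp.le h.tail0_nonneg h.tail1_nonneg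
  have hxs : Summable x := by
    have := hxR.summable_mul_pow (N := N) (r := 1) h.tail0_nonneg (fun i => tailSum_of_le _)
      h.tail1_nonneg (fun i => tailSum_of_le _) hx0 zero_le_one
      (by simp only [one_pow, mul_one, sum_tail1_eq_meanUp]; exact hst)
    simpa using this
  set c := (1 + ∑' i, x i)⁻¹ with hc
  have hX : 0 ≤ ∑' i, x i := tsum_nonneg hx0
  have hc0 : 0 < c := by positivity
  refine ⟨fun i => Nat.casesOn i c fun j => c * x j, ⟨?_, ?_, ?_⟩⟩
  · intro i
    cases i with
    | zero => exact hc0.le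
    | succ i => exact mul_nonneg hc0.le (hx0 i)
  · rw [← hasSum_nat_add_iff' 1]
    have hX1 : 1 - c = c * ∑' i, x i := by
      have : c * (1 + ∑' i, x i) = 1 := inv_mul_cancel₀ (by positivity)
      linarith
    simpa [hX1] using hxs.hasSum.mul_left c
  · rw [invariant_iff_cutFlow h, cutFlow_eq_zero_iff_isRenewal]
    exact hxR.smul

theorem IsStationaryDist.apply_zero (h : IsIncrementLaw N p0 p1)
    (hst : QueueStable N p1) (hs : IsStationaryDist (queueMatrix N p0 p1) s) :
    s 0 = (p1 (-1) - meanUp N p1) / (p1 (-1) - meanUp N p1 + emptyArrivalRate N p0) := by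
  have hb := hs.flow_balance h
  have hl := h.emptyArrivalRate_nonneg
  unfold QueueStable at hst
  rw [eq_div_iff (by linarith)]
  linarith

theorem QueueStable.existsUnique_isStationaryDist (h : IsIncrementLaw N p0 p1)
    (hst : QueueStable N p1) : ∃! s, IsStationaryDist (queueMatrix N p0 p1) s := by
  obtain ⟨s, hs⟩ := hst.exists_isStationaryDist h
  refine ⟨s, hs, fun t ht => ?_⟩
  have h0 : t 0 = s 0 := by rw [hs.apply_zero h hst, ht.apply_zero h hst]
  have ht' := ht.isRenewal h
  rw [h0] at ht'
  have := ht'.unique (hst.p1_neg_one_pos h).ne' (hs.isRenewal h)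
  funext i
  cases i with
  | zero => exact h0
  | succ i => exact congrFun this i

/-! ### The mean queue size -/

/-- The stationary distribution of a stable queue has geometric tails. -/
theorem IsStationaryDist.exists_summable_mul_pow (h : IsIncrementLaw N p0 p1)
    (hst : QueueStable N p1) (hs : IsStationaryDist (queueMatrix N p0 p1) s) :
    ∃ r : ℝ, 1 < r ∧ Summable fun i => ‖s i * r ^ i‖ := by
  obtain ⟨r, hr1, hr⟩ := exists_one_lt_sum_mul_pow_lt (N := N)
    (b := tailSum N fun k => p1 (k : ℤ)) (p := p1 (-1))
    (by rw [sum_tail1_eq_meanUp]; exact hst)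
  refine ⟨r, hr1, ?_⟩
  have := (hs.isRenewal h).summable_mul_pow (N := N) (r := r)
    (fun i => mul_nonneg (hs.nonneg 0) (h.tail0_nonneg i))
    (fun i hi => by rw [tailSum_of_le _ hi, mul_zero])
    h.tail1_nonneg (fun i => tailSum_of_le _) (fun i => hs.nonneg _) (by linarith) hr
  refine Summable.norm ?_
  rw [← summable_nat_add_iff 1]
  refine (this.mul_right r).congr fun i => ?_
  ring

/-- The functional equation of the generating function of a stationary distribution. -/
theorem IsStationaryDist.mul_tsum_sub_eq (h : IsIncrementLaw N p0 p1)
    (hs : IsStationaryDist (queueMatrix N p0 p1) s) {u : ℝ}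
    (hu : Summable fun i => ‖s i * u ^ i‖) :
    p1 (-1) * (∑' i, s i * u ^ i - s 0)
      = s 0 * ∑ i ∈ Finset.range N, tailSum N p0 i * u ^ (i + 1)
        + (∑ m ∈ Finset.range N, tailSum N (fun k => p1 (k : ℤ)) m * u ^ (m + 1))
          * (∑' i, s i * u ^ i - s 0) := by
  have hG : ∑' i, s i * u ^ i - s 0 = u * ∑' i, s (i + 1) * u ^ i := by
    rw [hu.of_norm.tsum_eq_zero_add, ← tsum_mul_left]
    simp only [pow_zero, mul_one, add_sub_cancel_left]
    exact tsum_congr fun i => by ring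
  rw [hG]
  have e : ∀ f : ℕ → ℝ, ∑ i ∈ Finset.range N, f i * u ^ (i + 1)
      = u * ∑ i ∈ Finset.range N, f i * u ^ i := fun f => by
    rw [Finset.mul_sum]
    exact Finset.sum_congr rfl fun i _ => by ring
  rcases eq_or_ne u 0 with rfl | hu0
  · simp
  have hsum : Summable fun i => ‖s (i + 1) * u ^ i‖ := by
    refine (((summable_nat_add_iff 1).2 hu).mul_left (‖u‖⁻¹)).congr fun i => ?_
    have : ‖u‖ ≠ 0 := norm_ne_zero_iff.2 hu0
    rw [pow_succ, norm_mul, norm_mul, norm_mul]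
    field_simp
  have := (hs.isRenewal h).mul_tsum_eq (N := N) (u := u)
    (fun i hi => by rw [tailSum_of_le _ hi, mul_zero]) (fun i hi => tailSum_of_le _ hi) hsum
  simp only [mul_assoc, ← Finset.mul_sum] at this
  rw [e, e]
  linear_combination u * this

/-- The mean, from the derivative of the functional equation at `1`. -/
theorem IsStationaryDist.mean_eq (h : IsIncrementLaw N p0 p1)
    (hst : QueueStable N p1) (hs : IsStationaryDist (queueMatrix N p0 p1) s) :
    (Summable fun i : ℕ => (i : ℝ) * s i) ∧
      HasDerivAt (fun u : ℝ => ∑' i, s i * u ^ i) (∑' i : ℕ, (i : ℝ) * s i) 1 ∧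
      (p1 (-1) - meanUp N p1) * ∑' i : ℕ, (i : ℝ) * s i
        = (s 0 * ∑ k ∈ Finset.Icc 1 N, (k : ℝ) * ((k : ℝ) + 1) * p0 k
          + (1 - s 0) * ∑ k ∈ Finset.Icc 1 N, (k : ℝ) * ((k : ℝ) + 1) * p1 (k : ℤ)) / 2 := by
  obtain ⟨r, hr1, hr⟩ := hs.exists_summable_mul_pow h hst
  obtain ⟨hsum, hd⟩ := hasDerivAt_tsum_mul_pow_one hr1 hr
  refine ⟨hsum, hd, ?_⟩
  have hpoly : ∀ f : ℕ → ℝ, HasDerivAt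
      (fun u : ℝ => ∑ i ∈ Finset.range N, tailSum N f i * u ^ (i + 1))
      ((∑ k ∈ Finset.Icc 1 N, (k : ℝ) * ((k : ℝ) + 1) * f k) / 2) 1 := fun f => by
    rw [← sum_succ_mul_tailSum]
    refine HasDerivAt.fun_sum fun i _ => ?_
    exact ((hasDerivAt_pow (i + 1) (1 : ℝ)).const_mul (tailSum N f i)).congr_deriv
      (by push_cast; simp [mul_comm])
  have hW := hd.sub_const (s 0)
  have hl := hW.const_mul (p1 (-1))
  have hrr := ((hpoly p0).const_mul (s 0)).add ((hpoly fun k => p1 (k : ℤ)).mul hW)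
  have heq : (fun u : ℝ => p1 (-1) * (∑' i, s i * u ^ i - s 0)) =ᶠ[nhds 1]
      fun u => s 0 * ∑ i ∈ Finset.range N, tailSum N p0 i * u ^ (i + 1)
        + (∑ m ∈ Finset.range N, tailSum N (fun k => p1 (k : ℤ)) m * u ^ (m + 1))
          * (∑' i, s i * u ^ i - s 0) := by
    filter_upwards [Ioo_mem_nhds zero_lt_one hr1] with u hu
    refine hs.mul_tsum_sub_eq h (Summable.of_norm_bounded hr fun i => ?_)
    rw [norm_norm, norm_mul, norm_mul, norm_pow, norm_pow]
    gcongr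
    rw [Real.norm_of_nonneg hu.1.le, Real.norm_of_nonneg (by linarith)]
    exact hu.2.le
  have key := (hl.congr_of_eventuallyEq heq.symm).unique hrr
  have h1 : ∑' i, s i * (1 : ℝ) ^ i = 1 := by simpa using hs.hasSum_one.tsum_eq
  simp only [one_pow, mul_one, sum_tail1_eq_meanUp] at key
  rw [hs.hasSum_one.tsum_eq] at key
  linarith

end Queue

/-! ### Second derivatives of the numerator and the denominator of `S'` -/

section Analytic

variable {f g : ℝ → ℝ} {x : ℝ}

/-- Of the second derivative `f''' g + f'' g' - f' g'' - f g'''` only the middle terms survive at a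
common zero of `f` and `g`. -/
theorem iteratedDeriv_two_wronskian (hf : AnalyticAt ℝ f x) (hg : AnalyticAt ℝ g x)
    (hf0 : f x = 0) (hg0 : g x = 0) :
    iteratedDeriv 2 (fun z => deriv f z * g z - f z * deriv g z) x
      = deriv (deriv f) x * deriv g x - deriv f x * deriv (deriv g) x := by
  have hd : ∀ {φ : ℝ → ℝ} {z : ℝ}, AnalyticAt ℝ φ z → HasDerivAt φ (deriv φ z) z :=
    fun h => h.differentiableAt.hasDerivAt
  have h1 : deriv (fun z => deriv f z * g z - f z * deriv g z) =ᶠ[nhds x]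
      fun z => deriv (deriv f) z * g z - f z * deriv (deriv g) z := by
    filter_upwards [hf.eventually_analyticAt, hg.eventually_analyticAt] with z hfz hgz
    refine (((hd hfz.deriv).mul (hd hgz)).sub ((hd hfz).mul (hd hgz.deriv))).deriv.trans ?_
    ring
  rw [iteratedDeriv_succ, iteratedDeriv_one, h1.deriv_eq]
  refine (((hd hf.deriv.deriv).mul (hd hg)).sub ((hd hf).mul (hd hg.deriv.deriv))).deriv.trans ?_
  rw [hf0, hg0]
  ring

theorem iteratedDeriv_two_sq (hg : AnalyticAt ℝ g x) (hg0 : g x = 0) :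
    iteratedDeriv 2 (fun z => g z ^ 2) x = 2 * deriv g x ^ 2 := by
  have hd : ∀ {φ : ℝ → ℝ} {z : ℝ}, AnalyticAt ℝ φ z → HasDerivAt φ (deriv φ z) z :=
    fun h => h.differentiableAt.hasDerivAt
  have h1 : deriv (fun z => g z ^ 2) =ᶠ[nhds x] fun z => 2 * (g z * deriv g z) := by
    filter_upwards [hg.eventually_analyticAt] with z hgz
    rw [((hd hgz).fun_pow 2).deriv]
    simp
    ring
  rw [iteratedDeriv_succ, iteratedDeriv_one, h1.deriv_eq]
  refine (((hd hg).mul (hd hg.deriv)).const_mul 2).deriv.trans ?_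
  rw [hg0]
  ring

end Analytic

/-- The Laurent polynomial `∑_{i < n} c_i z^{-i}`. -/
noncomputable def laurentSum (n : ℕ) (c : ℕ → ℝ) (z : ℝ) : ℝ :=
  ∑ i ∈ Finset.range n, c i * z ^ (-(i : ℤ))

section LaurentSum

variable {n : ℕ} {c : ℕ → ℝ} {z : ℝ}

theorem analyticAt_laurentSum (hz : z ≠ 0) : AnalyticAt ℝ (laurentSum n c) z := by
  unfold laurentSum
  exact Finset.analyticAt_fun_sum _ fun i _ => analyticAt_const.mul (analyticAt_id.fun_zpow hz)

theorem laurentSum_one : laurentSum n c 1 = ∑ i ∈ Finset.range n, c i := by simp [laurentSum]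

theorem deriv_laurentSum (hz : z ≠ 0) : deriv (laurentSum n c) z
    = ∑ i ∈ Finset.range n, c i * ((-(i : ℝ)) * z ^ (-(i : ℤ) - 1)) := by
  have := HasDerivAt.fun_sum (u := Finset.range n) (x := z)
    (A := fun i z => c i * z ^ (-(i : ℤ)))
    fun i _ => (hasDerivAt_zpow (-(i : ℤ)) z (Or.inl hz)).const_mul (c i)
  refine this.deriv.trans (Finset.sum_congr rfl fun i _ => ?_)
  push_cast
  rfl

theorem deriv_laurentSum_one :
    deriv (laurentSum n c) 1 = -∑ i ∈ Finset.range n, (i : ℝ) * c i := by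
  rw [deriv_laurentSum one_ne_zero, ← Finset.sum_neg_distrib]
  exact Finset.sum_congr rfl fun i _ => by simp [mul_comm]

theorem deriv_deriv_laurentSum_one :
    deriv (deriv (laurentSum n c)) 1
      = ∑ i ∈ Finset.range n, (i : ℝ) * ((i : ℝ) + 1) * c i := by
  have h : deriv (laurentSum n c) =ᶠ[nhds 1]
      fun z => ∑ i ∈ Finset.range n, c i * ((-(i : ℝ)) * z ^ (-(i : ℤ) - 1)) := by
    filter_upwards [isOpen_ne.mem_nhds (one_ne_zero (α := ℝ))] with z hz
    exact deriv_laurentSum hz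
  rw [h.deriv_eq]
  have := HasDerivAt.fun_sum (u := Finset.range n) (x := (1 : ℝ))
    (A := fun i z => c i * ((-(i : ℝ)) * z ^ (-(i : ℤ) - 1)))
    fun i _ => ((hasDerivAt_zpow (-(i : ℤ) - 1) (1 : ℝ) (Or.inl one_ne_zero)).const_mul
      (-(i : ℝ))).const_mul (c i)
  rw [this.deriv]
  refine Finset.sum_congr rfl fun i _ => ?_
  push_cast
  rw [one_zpow]
  ring

end LaurentSum

section Transforms

variable {N : ℕ} {p0 : ℕ → ℝ} {p1 : ℤ → ℝ}

theorem transA_eq_laurentSum : transA N p0 = laurentSum (N + 1) p0 := rfl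

theorem transB_eq_laurentSum :
    transB N p1 = laurentSum (N + 2) fun i => p1 ((i : ℤ) - 1) := rfl

theorem sum_range_succ_eq_sum_Icc {N : ℕ} (f : ℕ → ℝ) (h0 : f 0 = 0) :
    ∑ i ∈ Finset.range (N + 1), f i = ∑ k ∈ Finset.Icc 1 N, f k := by
  rw [sum_range_succ_eq_add_tailSum, h0, zero_add]
  rfl

theorem transA_one (h : IsIncrementLaw N p0 p1) : transA N p0 1 = 1 := by
  rw [transA_eq_laurentSum, laurentSum_one, h.p0_sum]

theorem deriv_transA_one : deriv (transA N p0) 1 = -emptyArrivalRate N p0 := by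
  rw [transA_eq_laurentSum, deriv_laurentSum_one, sum_range_succ_eq_sum_Icc _ (by simp)]
  rfl

theorem deriv_deriv_transA_one : deriv (deriv (transA N p0)) 1
    = ∑ k ∈ Finset.Icc 1 N, (k : ℝ) * ((k : ℝ) + 1) * p0 k := by
  rw [transA_eq_laurentSum, deriv_deriv_laurentSum_one, sum_range_succ_eq_sum_Icc _ (by simp)]

theorem transB_one (h : IsIncrementLaw N p0 p1) : transB N p1 1 = 1 := by
  rw [transB_eq_laurentSum, laurentSum_one, ← sum_Icc_neg_one, h.p1_sum]

/-- Moments of the shifted increment `k + 1` when the queue is not empty. -/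
theorem sum_mul_p1_shift (c : ℝ → ℝ) :
    ∑ i ∈ Finset.range (N + 2), c i * p1 ((i : ℤ) - 1)
      = c 0 * p1 (-1) + c 1 * p1 0
        + ∑ k ∈ Finset.Icc 1 N, c ((k : ℝ) + 1) * p1 (k : ℤ) := by
  have := sum_Icc_neg_one N fun k => c ((k : ℝ) + 1) * p1 k
  rw [sum_Icc_neg_one_eq_add] at this
  simpa using this.symm

theorem IsIncrementLaw.p1_zero_eq_sum (h : IsIncrementLaw N p0 p1) :
    p1 0 = 1 - p1 (-1) - ∑ k ∈ Finset.Icc 1 N, p1 (k : ℤ) := h.p1_zero_eq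

theorem deriv_transB_one (h : IsIncrementLaw N p0 p1) :
    deriv (transB N p1) 1 = p1 (-1) - meanUp N p1 - 1 := by
  rw [transB_eq_laurentSum, deriv_laurentSum_one, sum_mul_p1_shift fun x => x,
    h.p1_zero_eq_sum, meanUp]
  simp only [add_mul, Finset.sum_add_distrib, one_mul]
  ring

theorem deriv_deriv_transB_one (h : IsIncrementLaw N p0 p1) :
    deriv (deriv (transB N p1)) 1
      = 2 * (1 - p1 (-1)) + ∑ k ∈ Finset.Icc 1 N, (k : ℝ) * ((k : ℝ) + 3) * p1 (k : ℤ) := by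
  rw [transB_eq_laurentSum, deriv_deriv_laurentSum_one,
    sum_mul_p1_shift fun x => x * (x + 1), h.p1_zero_eq_sum]
  have e : ∀ k : ℕ, ((k : ℝ) + 1) * ((k : ℝ) + 1 + 1) * p1 (k : ℤ)
      = (k : ℝ) * ((k : ℝ) + 3) * p1 (k : ℤ) + 2 * p1 (k : ℤ) := fun k => by ring
  simp only [e, Finset.sum_add_distrib, ← Finset.mul_sum]
  ring

theorem sum_mul_add_three (N : ℕ) (f : ℕ → ℝ) :
    ∑ k ∈ Finset.Icc 1 N, (k : ℝ) * ((k : ℝ) + 3) * f k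
      = ∑ k ∈ Finset.Icc 1 N, (k : ℝ) * ((k : ℝ) + 1) * f k
        + 2 * ∑ k ∈ Finset.Icc 1 N, (k : ℝ) * f k := by
  rw [Finset.mul_sum, ← Finset.sum_add_distrib]
  exact Finset.sum_congr rfl fun k _ => by ring

theorem analyticAt_transA {z : ℝ} (hz : z ≠ 0) : AnalyticAt ℝ (transA N p0) z :=
  analyticAt_laurentSum hz

theorem analyticAt_transB {z : ℝ} (hz : z ≠ 0) : AnalyticAt ℝ (transB N p1) z :=
  analyticAt_laurentSum hz

theorem hasDerivAt_inv_mul_transA_sub_transB {z : ℝ} (hz : z ≠ 0) :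
    HasDerivAt (fun z => z⁻¹ * transA N p0 z - transB N p1 z)
      (-(z ^ (-2 : ℤ)) * transA N p0 z + z⁻¹ * deriv (transA N p0) z - deriv (transB N p1) z)
      z := by
  have hA := (analyticAt_transA (N := N) (p0 := p0) hz).differentiableAt.hasDerivAt
  have hB := (analyticAt_transB (N := N) (p1 := p1) hz).differentiableAt.hasDerivAt
  exact ((((hasDerivAt_inv hz).mul hA).sub hB)).congr_deriv (by
    rw [zpow_neg]; norm_cast)

theorem hasDerivAt_inv_sub_transB {z : ℝ} (hz : z ≠ 0) :
    HasDerivAt (fun z => z⁻¹ - transB N p1 z) (-(z ^ (-2 : ℤ)) - deriv (transB N p1) z) z := by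
  have hB := (analyticAt_transB (N := N) (p1 := p1) hz).differentiableAt.hasDerivAt
  exact ((hasDerivAt_inv hz).sub hB).congr_deriv (by rw [zpow_neg]; norm_cast)

theorem deriv_deriv_inv_mul_transA_sub_transB_one :
    deriv (deriv fun z => z⁻¹ * transA N p0 z - transB N p1 z) 1
      = 2 * transA N p0 1 - 2 * deriv (transA N p0) 1 + deriv (deriv (transA N p0)) 1
        - deriv (deriv (transB N p1)) 1 := by
  have h : deriv (fun z => z⁻¹ * transA N p0 z - transB N p1 z) =ᶠ[nhds 1]
      fun z => -(z ^ (-2 : ℤ)) * transA N p0 z + z⁻¹ * deriv (transA N p0) z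
        - deriv (transB N p1) z := by
    filter_upwards [isOpen_ne.mem_nhds (one_ne_zero (α := ℝ))] with z hz
    exact (hasDerivAt_inv_mul_transA_sub_transB hz).deriv
  have hA := analyticAt_transA (N := N) (p0 := p0) one_ne_zero
  have hA0 := hA.differentiableAt.hasDerivAt
  have hA1 := hA.deriv.differentiableAt.hasDerivAt
  have hB1 := (analyticAt_transB (N := N) (p1 := p1)
    one_ne_zero).deriv.differentiableAt.hasDerivAt
  have hz := (hasDerivAt_zpow (-2) (1 : ℝ) (Or.inl one_ne_zero)).neg
  rw [h.deriv_eq]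
  refine (((hz.mul hA0).add ((hasDerivAt_inv one_ne_zero).mul hA1)).sub hB1).deriv.trans ?_
  norm_num
  ring

theorem deriv_deriv_inv_sub_transB_one :
    deriv (deriv fun z => z⁻¹ - transB N p1 z) 1 = 2 - deriv (deriv (transB N p1)) 1 := by
  have h : deriv (fun z => z⁻¹ - transB N p1 z) =ᶠ[nhds 1]
      fun z => -(z ^ (-2 : ℤ)) - deriv (transB N p1) z := by
    filter_upwards [isOpen_ne.mem_nhds (one_ne_zero (α := ℝ))] with z hz
    exact (hasDerivAt_inv_sub_transB hz).deriv
  have hB1 := (analyticAt_transB (N := N) (p1 := p1)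
    one_ne_zero).deriv.differentiableAt.hasDerivAt
  have hz := (hasDerivAt_zpow (-2) (1 : ℝ) (Or.inl one_ne_zero)).neg
  rw [h.deriv_eq]
  refine (hz.sub hB1).deriv.trans ?_
  norm_num

theorem iteratedDeriv_two_transL_one (h : IsIncrementLaw N p0 p1) :
    iteratedDeriv 2 (transL N p1) 1 = 2 * (p1 (-1) - meanUp N p1) ^ 2 := by
  have hg : AnalyticAt ℝ (fun z => z⁻¹ - transB N p1 z) 1 :=
    (analyticAt_inv one_ne_zero).sub (analyticAt_transB one_ne_zero)
  have := iteratedDeriv_two_sq hg (by rw [transB_one h, inv_one, sub_self])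
  rw [(hasDerivAt_inv_sub_transB one_ne_zero).deriv, deriv_transB_one h] at this
  unfold transL
  rw [this, one_zpow]
  ring

theorem iteratedDeriv_two_transK_one (h : IsIncrementLaw N p0 p1) :
    iteratedDeriv 2 (transK N p0 p1) 1
      = (meanUp N p1 - p1 (-1)) * ∑ k ∈ Finset.Icc 1 N, (k : ℝ) * ((k : ℝ) + 3) * p0 k
        + emptyArrivalRate N p0
          * (2 * p1 (-1) - ∑ k ∈ Finset.Icc 1 N, (k : ℝ) * ((k : ℝ) + 3) * p1 (k : ℤ)) := by
  have hg : AnalyticAt ℝ (fun z => z⁻¹ - transB N p1 z) 1 :=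
    (analyticAt_inv one_ne_zero).sub (analyticAt_transB one_ne_zero)
  have hf : AnalyticAt ℝ (fun z => z⁻¹ * transA N p0 z - transB N p1 z) 1 :=
    ((analyticAt_inv one_ne_zero).mul (analyticAt_transA one_ne_zero)).sub
      (analyticAt_transB one_ne_zero)
  have hK : transK N p0 p1 =ᶠ[nhds 1] fun z =>
      deriv (fun z => z⁻¹ * transA N p0 z - transB N p1 z) z * (z⁻¹ - transB N p1 z)
        - (z⁻¹ * transA N p0 z - transB N p1 z) * deriv (fun z => z⁻¹ - transB N p1 z) z := by
    filter_upwards [isOpen_ne.mem_nhds (one_ne_zero (α := ℝ))] with z hz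
    rw [(hasDerivAt_inv_mul_transA_sub_transB hz).deriv, (hasDerivAt_inv_sub_transB hz).deriv]
    rfl
  rw [hK.iteratedDeriv_eq, iteratedDeriv_two_wronskian hf hg
    (by rw [transA_one h, transB_one h, inv_one, one_mul, sub_self])
    (by rw [transB_one h, inv_one, sub_self]),
    deriv_deriv_inv_mul_transA_sub_transB_one, deriv_deriv_inv_sub_transB_one,
    (hasDerivAt_inv_mul_transA_sub_transB one_ne_zero).deriv,
    (hasDerivAt_inv_sub_transB one_ne_zero).deriv, transA_one h, deriv_transA_one,
    deriv_transB_one h, deriv_deriv_transA_one, deriv_deriv_transB_one h,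
    sum_mul_add_three N p0, one_zpow, inv_one]
  unfold emptyArrivalRate
  ring

/-- The z-transform is the generating function at `z⁻¹`. -/
theorem hasDerivAt_transS_one {s : ℕ → ℝ} {Q : ℝ}
    (hd : HasDerivAt (fun u : ℝ => ∑' i, s i * u ^ i) Q 1) : HasDerivAt (transS s) (-Q) 1 := by
  have e : transS s = (fun u : ℝ => ∑' i, s i * u ^ i) ∘ fun z => z⁻¹ := by
    funext z
    simp [transS, zpow_neg]
  rw [e]
  have hi : HasDerivAt (fun z : ℝ => z⁻¹) (-1) 1 :=
    (hasDerivAt_inv one_ne_zero).congr_deriv (by norm_num)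
  exact (HasDerivAt.comp (1 : ℝ) (by simpa using hd) hi).congr_deriv (by ring)

theorem queue_steady_state {s : ℕ → ℝ} (h : IsIncrementLaw N p0 p1) (hst : QueueStable N p1)
    (hs : IsStationaryDist (queueMatrix N p0 p1) s) :
    s 0 = (p1 (-1) - meanUp N p1) / (p1 (-1) - meanUp N p1 + emptyArrivalRate N p0) ∧
    s 0 = (1 + deriv (transB N p1) 1) / (1 + deriv (transB N p1) 1 - deriv (transA N p0) 1) ∧
    ∃ Qbar : ℝ,
      HasSum (fun i : ℕ => (i : ℝ) * s i) Qbar ∧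
      HasDerivAt (transS s) (-Qbar) 1 ∧
      iteratedDeriv 2 (transL N p1) 1 ≠ 0 ∧
      Qbar = -(s 0 * (iteratedDeriv 2 (transK N p0 p1) 1 / iteratedDeriv 2 (transL N p1) 1)) ∧
      Qbar =
        ((meanUp N p1 - p1 (-1)) * ∑ k ∈ Finset.Icc 1 N, (k : ℝ) * ((k : ℝ) + 3) * p0 k
          + emptyArrivalRate N p0
            * (2 * p1 (-1) - ∑ k ∈ Finset.Icc 1 N, (k : ℝ) * ((k : ℝ) + 3) * p1 (k : ℤ)))
        / (2 * (meanUp N p1 - p1 (-1))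
          * (p1 (-1) - meanUp N p1 + emptyArrivalRate N p0)) := by
  have h0 := hs.apply_zero h hst
  obtain ⟨hsum, hd, hQ⟩ := hs.mean_eq h hst
  have hpos : 0 < p1 (-1) - meanUp N p1 := sub_pos.2 hst
  have hl := h.emptyArrivalRate_nonneg
  have hden : p1 (-1) - meanUp N p1 + emptyArrivalRate N p0 ≠ 0 := by linarith
  have hneg : meanUp N p1 - p1 (-1) ≠ 0 := by linarith
  have hval : ∑' i : ℕ, (i : ℝ) * s i =
        ((meanUp N p1 - p1 (-1)) * ∑ k ∈ Finset.Icc 1 N, (k : ℝ) * ((k : ℝ) + 3) * p0 k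
          + emptyArrivalRate N p0
            * (2 * p1 (-1) - ∑ k ∈ Finset.Icc 1 N, (k : ℝ) * ((k : ℝ) + 3) * p1 (k : ℤ)))
        / (2 * (meanUp N p1 - p1 (-1))
          * (p1 (-1) - meanUp N p1 + emptyArrivalRate N p0)) := by
    have e0 := sum_mul_add_three N p0
    have e1 := sum_mul_add_three N fun k => p1 (k : ℤ)
    change _ = _ + 2 * emptyArrivalRate N p0 at e0
    change _ = _ + 2 * meanUp N p1 at e1
    rw [e0, e1, eq_div_iff (mul_ne_zero (mul_ne_zero two_ne_zero hneg) hden)]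
    have hs0 : s 0 * (p1 (-1) - meanUp N p1 + emptyArrivalRate N p0)
        = p1 (-1) - meanUp N p1 := by rw [h0, div_mul_cancel₀ _ hden]
    set X := ∑ k ∈ Finset.Icc 1 N, (k : ℝ) * ((k : ℝ) + 1) * p0 k
    set Y := ∑ k ∈ Finset.Icc 1 N, (k : ℝ) * ((k : ℝ) + 1) * p1 (k : ℤ)
    linear_combination
      (-2 * (p1 (-1) - meanUp N p1 + emptyArrivalRate N p0)) * hQ + (Y - X) * hs0
  refine ⟨h0, ?_, _, hsum.hasSum, hasDerivAt_transS_one hd, ?_, ?_, hval⟩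
  · rw [h0, deriv_transB_one h, deriv_transA_one]
    congr 1 <;> ring
  · rw [iteratedDeriv_two_transL_one h]
    positivity
  · rw [hval, h0, iteratedDeriv_two_transK_one h, iteratedDeriv_two_transL_one h]
    have hpos' := hpos.ne'
    have : meanUp N p1 - p1 (-1) = -(p1 (-1) - meanUp N p1) := by ring
    rw [this]
    generalize p1 (-1) - meanUp N p1 = d at *
    field_simp

end Transforms

/-! ### The relay network -/

namespace RelayNetwork

/-- The binomial probability of `k` successes in `n` trials with success probability `x`. -/
def binomProb (n : ℕ) (x : ℝ) (k : ℕ) : ℝ := (n.choose k : ℝ) * x ^ k * (1 - x) ^ (n - k)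

theorem sum_binomProb (n : ℕ) (x : ℝ) : ∑ k ∈ Finset.range (n + 1), binomProb n x k = 1 := by
  have h := add_pow x (1 - x) n
  rw [add_sub_cancel, one_pow] at h
  rw [h]
  exact Finset.sum_congr rfl fun k _ => by unfold binomProb; ring

theorem binomProb_nonneg {x : ℝ} (hx : x ∈ Set.Icc (0 : ℝ) 1) (n k : ℕ) :
    0 ≤ binomProb n x k :=
  mul_nonneg (mul_nonneg (by positivity) (pow_nonneg hx.1 _)) (pow_nonneg (sub_nonneg.2 hx.2) _)

variable (net : RelayNetwork)

/-- The expectation of `φ m i j` over the transmission choices of the users. -/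
def choiceMean (φ : ℕ → ℕ → ℕ → ℝ) : ℝ :=
  ∑ m ∈ Finset.range (net.N + 1), ∑ i ∈ Finset.range (m + 1), ∑ j ∈ Finset.range (i + 1),
    net.weight m i j * φ m i j

theorem weight_eq (m i j : ℕ) : net.weight m i j
    = binomProb net.N net.qtx m * (binomProb m net.quf i * binomProb i net.qur j) := by
  simp only [weight, binomProb]; ring

theorem weight_nonneg (m i j : ℕ) : 0 ≤ net.weight m i j := by
  rw [weight_eq]
  exact mul_nonneg (binomProb_nonneg net.qtx_mem _ _)
    (mul_nonneg (binomProb_nonneg net.quf_mem _ _) (binomProb_nonneg net.qur_mem _ _))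

theorem choiceMean_const (c : ℝ) : net.choiceMean (fun _ _ _ => c) = c := by
  simp only [choiceMean, weight_eq, ← Finset.sum_mul, ← Finset.mul_sum, sum_binomProb, mul_one,
    one_mul]

variable {net}

theorem choiceMean_congr {φ ψ : ℕ → ℕ → ℕ → ℝ}
    (h : ∀ m i j, m ≤ net.N → i ≤ m → j ≤ i → φ m i j = ψ m i j) :
    net.choiceMean φ = net.choiceMean ψ := by
  refine Finset.sum_congr rfl fun m hm => Finset.sum_congr rfl fun i hi =>
    Finset.sum_congr rfl fun j hj => ?_
  simp only [Finset.mem_range, Nat.lt_succ_iff] at hm hi hj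
  rw [h m i j hm hi hj]

theorem choiceMean_mono {φ ψ : ℕ → ℕ → ℕ → ℝ}
    (h : ∀ m i j, m ≤ net.N → i ≤ m → j ≤ i → φ m i j ≤ ψ m i j) :
    net.choiceMean φ ≤ net.choiceMean ψ := by
  refine Finset.sum_le_sum fun m hm => Finset.sum_le_sum fun i hi =>
    Finset.sum_le_sum fun j hj => ?_
  simp only [Finset.mem_range, Nat.lt_succ_iff] at hm hi hj
  exact mul_le_mul_of_nonneg_left (h m i j hm hi hj) (net.weight_nonneg m i j)

theorem choiceMean_nonneg {φ : ℕ → ℕ → ℕ → ℝ} (h : ∀ m i j, 0 ≤ φ m i j) :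
    0 ≤ net.choiceMean φ := by
  have := choiceMean_mono (net := net) (φ := fun _ _ _ => 0) (ψ := φ) fun m i j _ _ _ => h m i j
  rwa [choiceMean_const] at this

variable (net)

theorem choiceMean_add (φ ψ : ℕ → ℕ → ℕ → ℝ) :
    net.choiceMean (fun m i j => φ m i j + ψ m i j) = net.choiceMean φ + net.choiceMean ψ := by
  simp only [choiceMean, mul_add, Finset.sum_add_distrib]

theorem choiceMean_sub (φ ψ : ℕ → ℕ → ℕ → ℝ) :
    net.choiceMean (fun m i j => φ m i j - ψ m i j) = net.choiceMean φ - net.choiceMean ψ := by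
  simp only [choiceMean, mul_sub, Finset.sum_sub_distrib]

theorem choiceMean_mul_left (c : ℝ) (φ : ℕ → ℕ → ℕ → ℝ) :
    net.choiceMean (fun m i j => c * φ m i j) = c * net.choiceMean φ := by
  simp only [choiceMean, mul_left_comm _ c, ← Finset.mul_sum]

theorem choiceMean_sum {ι : Type*} (t : Finset ι) (φ : ι → ℕ → ℕ → ℕ → ℝ) :
    net.choiceMean (fun m i j => ∑ k ∈ t, φ k m i j) = ∑ k ∈ t, net.choiceMean (φ k) := by
  classical
  induction t using Finset.induction_on with
  | empty => simp [choiceMean]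
  | insert a t ha ih => simp only [Finset.sum_insert ha, choiceMean_add, ih]

theorem fdSucc_mem (m i j : ℕ) : net.fdSucc m i j ∈ Set.Icc (0 : ℝ) 1 := net.Puf_mem _ _

theorem brSucc_mem (r : Bool) (m i j : ℕ) : net.brSucc r m i j ∈ Set.Icc (0 : ℝ) 1 := by
  have h1 := net.Pub_mem j (m - i - 1)
  have h2 := net.Pud_mem r (i - j) (m - i - 1)
  have h3 : 0 ≤ 1 - net.Pud r (i - j) (m - i - 1) := sub_nonneg.2 h2.2
  exact ⟨mul_nonneg h1.1 h3, mul_le_one₀ h1.2 h3 (by linarith [h2.1])⟩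

theorem recvGiven_eq (r : Bool) (k m i j : ℕ) : net.recvGiven r k m i j
    = ∑ kf ∈ Finset.Icc (k + i - m) (min j k),
      binomProb j (net.fdSucc m i j) kf * binomProb (m - i) (net.brSucc r m i j) (k - kf) := rfl

theorem recvGiven_nonneg (r : Bool) (k m i j : ℕ) : 0 ≤ net.recvGiven r k m i j := by
  rw [recvGiven_eq]
  exact Finset.sum_nonneg fun kf _ => mul_nonneg (binomProb_nonneg (net.fdSucc_mem _ _ _) _ _)
    (binomProb_nonneg (net.brSucc_mem _ _ _ _) _ _)

/-- At most `j + (m - i)` packets are sent to the relay or broadcast. -/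
theorem recvGiven_eq_zero (r : Bool) {k m i j : ℕ} (h : j < k + i - m) :
    net.recvGiven r k m i j = 0 := by
  rw [recvGiven, Finset.Icc_eq_empty (by have := min_le_left j k; omega), Finset.sum_empty]

theorem recvGiven_zero (r : Bool) {m i : ℕ} (hi : i ≤ m) (j : ℕ) :
    net.recvGiven r 0 m i j
      = (1 - net.fdSucc m i j) ^ j * (1 - net.brSucc r m i j) ^ (m - i) := by
  have h : i - m = 0 := by omega
  simp [recvGiven, h]

/-- Given the transmission choices, the number of received packets has a probability law: it is
the sum of two independent binomial variables. -/
theorem sum_recvGiven (r : Bool) {m i j n : ℕ} (hm : m ≤ n) (hi : i ≤ m) (hj : j ≤ i) :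
    ∑ k ∈ Finset.range (n + 1), net.recvGiven r k m i j = 1 := by
  have h : ∑ kf ∈ Finset.range (j + 1), ∑ l ∈ Finset.range (m - i + 1),
      binomProb j (net.fdSucc m i j) kf * binomProb (m - i) (net.brSucc r m i j) l = 1 := by
    simp only [← Finset.mul_sum, sum_binomProb, mul_one]
  rw [← h]
  simp only [recvGiven_eq]
  rw [Finset.sum_sigma', Finset.sum_sigma']
  refine Finset.sum_bij' (fun a _ => ⟨a.2, a.1 - a.2⟩) (fun a _ => ⟨a.1 + a.2, a.1⟩)
    ?_ ?_ ?_ ?_ ?_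
  all_goals
    rintro ⟨a, b⟩ h
    simp only [Finset.mem_sigma, Finset.mem_range, Finset.mem_Icc, le_min_iff] at h ⊢
  · omega
  · omega
  · rw [show b + (a - b) = a by omega]
  · rw [show a + b - a = b by omega]

/-- The summation ranges of `Σ_k` only omit terms that vanish. -/
theorem sum_recvGiven_mul_eq_choiceMean (r : Bool) (k : ℕ) (c : ℕ → ℕ → ℕ → ℝ) :
    ∑ m ∈ Finset.Icc k net.N, ∑ i ∈ Finset.range (m + 1), ∑ j ∈ Finset.Icc (k + i - m) i,
      net.weight m i j * net.recvGiven r k m i j * c m i j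
      = net.choiceMean fun m i j => net.recvGiven r k m i j * c m i j := by
  have inner : ∀ m i, ∑ j ∈ Finset.Icc (k + i - m) i,
      net.weight m i j * net.recvGiven r k m i j * c m i j
      = ∑ j ∈ Finset.range (i + 1), net.weight m i j * (net.recvGiven r k m i j * c m i j) := by
    intro m i
    simp only [mul_assoc]
    refine Finset.sum_subset (fun j hj => ?_) fun j hj hj' => ?_
    · simp only [Finset.mem_Icc, Finset.mem_range] at *
      omega
    · simp only [Finset.mem_Icc, Finset.mem_range] at *
      rw [recvGiven_eq_zero net r (by omega), zero_mul, mul_zero]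
  simp only [inner]
  refine Finset.sum_subset (fun m hm => ?_) fun m hm hm' => ?_
  · simp only [Finset.mem_Icc, Finset.mem_range] at *
    omega
  · refine Finset.sum_eq_zero fun i _ => Finset.sum_eq_zero fun j hj => ?_
    simp only [Finset.mem_Icc, Finset.mem_range] at *
    rw [recvGiven_eq_zero net r (by omega), zero_mul, mul_zero]

theorem sum_recvGiven_eq_choiceMean (r : Bool) (k : ℕ) :
    ∑ m ∈ Finset.Icc k net.N, ∑ i ∈ Finset.range (m + 1), ∑ j ∈ Finset.Icc (k + i - m) i,
      net.weight m i j * net.recvGiven r k m i j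
      = net.choiceMean (net.recvGiven r k) := by
  simpa only [mul_one] using net.sum_recvGiven_mul_eq_choiceMean r k fun _ _ _ => 1

theorem r0_eq (k : ℕ) : net.r0 k = net.choiceMean (net.recvGiven false k) :=
  net.sum_recvGiven_eq_choiceMean false k

theorem r1_eq (k : ℕ) : net.r1 k = (1 - net.qr) * net.choiceMean (net.recvGiven false k)
    + net.qr * net.choiceMean (net.recvGiven true k) := by
  rw [r1, r0_eq, sum_recvGiven_eq_choiceMean]

theorem mu_eq : net.mu = net.qr * net.choiceMean fun m i j => net.Prd (i - j) (m - i) := rfl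

theorem p1Down_eq : net.p1Down = net.qr * net.choiceMean fun m i j =>
    net.recvGiven true 0 m i j * net.Prd (i - j) (m - i) := by
  rw [p1Down]
  congr 1
  refine Finset.sum_congr rfl fun m _ => Finset.sum_congr rfl fun i hi =>
    Finset.sum_congr rfl fun j _ => ?_
  beta_reduce
  rw [recvGiven_zero net true (Nat.lt_succ_iff.1 (Finset.mem_range.1 hi))]
  ring

theorem p1Up_eq (k : ℕ) : net.p1Up k = (1 - net.qr) * net.choiceMean (net.recvGiven false k)
    + net.qr * net.choiceMean (fun m i j =>
      net.recvGiven true k m i j * (1 - net.Prd (i - j) (m - i)))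
    + net.qr * net.choiceMean (fun m i j =>
      net.recvGiven true (k + 1) m i j * net.Prd (i - j) (m - i)) := by
  rw [p1Up, r0_eq, sum_recvGiven_mul_eq_choiceMean net true k,
    sum_recvGiven_mul_eq_choiceMean net true (k + 1)]

/-- Any functional of the upward increments is an expectation over the transmission choices. -/
theorem sum_mul_p1Up (c : ℕ → ℝ) : ∑ k ∈ Finset.Icc 1 net.N, c k * net.p1Up k
    = net.choiceMean fun m i j =>
      (1 - net.qr) * ∑ k ∈ Finset.Icc 1 net.N, c k * net.recvGiven false k m i j
      + net.qr * ((1 - net.Prd (i - j) (m - i))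
          * ∑ k ∈ Finset.Icc 1 net.N, c k * net.recvGiven true k m i j
        + net.Prd (i - j) (m - i)
          * ∑ k ∈ Finset.Icc 1 net.N, c k * net.recvGiven true (k + 1) m i j) := by
  simp only [p1Up_eq, ← choiceMean_mul_left, ← choiceMean_add, ← choiceMean_sum]
  refine choiceMean_congr fun m i j _ _ _ => ?_
  simp only [Finset.mul_sum, ← Finset.sum_add_distrib]
  exact Finset.sum_congr rfl fun k _ => by ring

theorem sum_mul_recvGiven_succ (r : Bool) {m i j : ℕ} (hm : m ≤ net.N)
    (hj : j ≤ i) (c : ℕ → ℝ) :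
    ∑ k ∈ Finset.Icc 1 net.N, c k * net.recvGiven r (k + 1) m i j
      = ∑ k ∈ Finset.Icc 1 net.N, c (k - 1) * net.recvGiven r k m i j
        - c 0 * net.recvGiven r 1 m i j := by
  have h := sum_range_succ_eq_add_tailSum net.N fun k => c k * net.recvGiven r (k + 1) m i j
  have h2 : ∑ k ∈ Finset.Icc 1 net.N, c (k - 1) * net.recvGiven r k m i j
      = ∑ k ∈ Finset.range net.N, c k * net.recvGiven r (k + 1) m i j := by
    rw [← Finset.Ico_add_one_right_eq_Icc, Finset.sum_Ico_eq_sum_range]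
    refine Finset.sum_congr (by simp) fun k _ => ?_
    rw [add_comm 1 k, Nat.add_sub_cancel]
  rw [Finset.sum_range_succ, recvGiven_eq_zero net r (by omega), mul_zero, add_zero] at h
  rw [h2, h]
  exact (add_sub_cancel_left _ _).symm

theorem sum_Icc_recvGiven (r : Bool) {m i j : ℕ} (hm : m ≤ net.N) (hi : i ≤ m)
    (hj : j ≤ i) :
    ∑ k ∈ Finset.Icc 1 net.N, net.recvGiven r k m i j = 1 - net.recvGiven r 0 m i j := by
  have h := sum_range_succ_eq_add_tailSum net.N fun k => net.recvGiven r k m i j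
  rw [sum_recvGiven net r hm hi hj] at h
  rw [h]
  exact (add_sub_cancel_left _ _).symm

theorem p1Down_nonneg : 0 ≤ net.p1Down := by
  rw [p1Down_eq]
  exact mul_nonneg net.qr_mem.1 (choiceMean_nonneg fun m i j =>
    mul_nonneg (net.recvGiven_nonneg _ _ _ _ _) (net.Prd_mem _ _).1)

theorem p1Up_nonneg (k : ℕ) : 0 ≤ net.p1Up k := by
  rw [p1Up_eq]
  refine add_nonneg (add_nonneg (mul_nonneg (sub_nonneg.2 net.qr_mem.2) ?_)
    (mul_nonneg net.qr_mem.1 ?_)) (mul_nonneg net.qr_mem.1 ?_) <;>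
    refine choiceMean_nonneg fun m i j => ?_
  · exact net.recvGiven_nonneg _ _ _ _ _
  · exact mul_nonneg (net.recvGiven_nonneg _ _ _ _ _) (sub_nonneg.2 (net.Prd_mem _ _).2)
  · exact mul_nonneg (net.recvGiven_nonneg _ _ _ _ _) (net.Prd_mem _ _).1

/-- This says `p_0^1 ≥ 0`: the events behind `p_{-1}^1` and `p_k^1`, `k ≥ 1`, are disjoint. -/
theorem p1Down_add_sum_p1Up_le_one :
    net.p1Down + ∑ k ∈ Finset.Icc 1 net.N, net.p1Up k ≤ 1 := by
  have h := net.sum_mul_p1Up fun _ => 1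
  simp only [one_mul] at h
  rw [h, p1Down_eq, ← choiceMean_mul_left, ← choiceMean_add]
  refine le_of_le_of_eq (choiceMean_mono fun m i j hm hi hj => ?_) (net.choiceMean_const 1)
  have hs := net.sum_mul_recvGiven_succ true hm hj fun _ => 1
  simp only [one_mul] at hs
  rw [hs, sum_Icc_recvGiven net true hm hi hj, sum_Icc_recvGiven net false hm hi hj]
  have hq := net.qr_mem
  have hD := net.Prd_mem (i - j) (m - i)
  have a0 := net.recvGiven_nonneg false 0 m i j
  have b0 := net.recvGiven_nonneg true 0 m i j
  have b1 := net.recvGiven_nonneg true 1 m i j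
  have q' := sub_nonneg.2 hq.2
  have D' := sub_nonneg.2 hD.2
  have t1 := mul_nonneg q' a0
  have t2 := mul_nonneg (mul_nonneg hq.1 D') b0
  have t3 := mul_nonneg (mul_nonneg hq.1 hD.1) b1
  linarith

/-- The drift of the non-empty queue is the arrival rate minus the service rate: a successful
transmission of the relay lowers the increment by one, whatever is received. -/
theorem sum_mul_p1Up_sub_p1Down :
    ∑ k ∈ Finset.Icc 1 net.N, (k : ℝ) * net.p1Up k - net.p1Down = net.lam1 - net.mu := by
  have hl : net.lam1 = net.choiceMean fun m i j =>
      (1 - net.qr) * ∑ k ∈ Finset.Icc 1 net.N, (k : ℝ) * net.recvGiven false k m i j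
      + net.qr * ∑ k ∈ Finset.Icc 1 net.N, (k : ℝ) * net.recvGiven true k m i j := by
    simp only [lam1, r1_eq, ← choiceMean_mul_left, ← choiceMean_add, ← choiceMean_sum]
    refine choiceMean_congr fun m i j _ _ _ => ?_
    simp only [Finset.mul_sum, ← Finset.sum_add_distrib]
    exact Finset.sum_congr rfl fun k _ => by ring
  rw [hl, sum_mul_p1Up, p1Down_eq, mu_eq, ← choiceMean_mul_left, ← choiceMean_mul_left,
    ← choiceMean_sub, ← choiceMean_sub]
  refine choiceMean_congr fun m i j hm hi hj => ?_
  have hs := net.sum_mul_recvGiven_succ true hm hj fun k => (k : ℝ)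
  have he : ∑ k ∈ Finset.Icc 1 net.N, ((k - 1 : ℕ) : ℝ) * net.recvGiven true k m i j
      = ∑ k ∈ Finset.Icc 1 net.N, (k : ℝ) * net.recvGiven true k m i j
        - (1 - net.recvGiven true 0 m i j) := by
    rw [← sum_Icc_recvGiven net true hm hi hj, ← Finset.sum_sub_distrib]
    refine Finset.sum_congr rfl fun k hk => ?_
    rw [Nat.cast_sub (Finset.mem_Icc.1 hk).1]
    push_cast
    ring
  rw [hs, he]
  push_cast
  ring

theorem p1_neg_one : net.p1 (-1) = net.p1Down := by simp [p1]

theorem p1_natCast {k : ℕ} (hk : 1 ≤ k) : net.p1 (k : ℤ) = net.p1Up k := by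
  rw [p1, if_neg (by omega), if_neg (by omega), Int.toNat_natCast]

theorem isIncrementLaw : IsIncrementLaw net.N net.p0 net.p1 where
  p0_nonneg k _ := by
    rw [p0, r0_eq]
    exact choiceMean_nonneg fun m i j => net.recvGiven_nonneg _ _ _ _ _
  p0_sum := by
    simp only [p0, r0_eq]
    rw [← choiceMean_sum, ← net.choiceMean_const 1]
    exact choiceMean_congr fun m i j hm hi hj => net.sum_recvGiven false hm hi hj
  p1_nonneg k _ := by
    rw [p1]
    split_ifs
    · exact net.p1Down_nonneg
    · linarith [net.p1Down_add_sum_p1Up_le_one]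
    · exact net.p1Up_nonneg _
  p1_sum := by
    rw [sum_Icc_neg_one_eq_add, Finset.sum_congr rfl fun k hk =>
      net.p1_natCast (Finset.mem_Icc.1 hk).1, p1_neg_one]
    simp only [p1, if_true]
    norm_num
    ring

theorem queueStable_iff : QueueStable net.N net.p1 ↔ net.lam1 < net.mu := by
  have h := net.sum_mul_p1Up_sub_p1Down
  have hm : meanUp net.N net.p1 = ∑ k ∈ Finset.Icc 1 net.N, (k : ℝ) * net.p1Up k :=
    Finset.sum_congr rfl fun k hk => by rw [net.p1_natCast (Finset.mem_Icc.1 hk).1]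
  rw [QueueStable, hm, p1_neg_one, ← sub_neg, h, sub_neg]

end RelayNetwork

/-! ### Conclusion -/

theorem mainTheorem3 :
    -- queue with arbitrary increment laws
    (∀ (N : ℕ) (p0 : ℕ → ℝ) (p1 : ℤ → ℝ), IsIncrementLaw N p0 p1 →
      -- the transition matrix is stochastic and lower Hessenberg
      ((∀ i j, 0 ≤ queueMatrix N p0 p1 i j) ∧
        (∀ j, HasSum (fun i => queueMatrix N p0 p1 i j) 1) ∧
        (∀ i j, i + 1 < j → queueMatrix N p0 p1 i j = 0)) ∧
      -- stability is the existence of a steady state as soon as the queue can move up from `0`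
      -- and can move down
      (0 < emptyArrivalRate N p0 → 0 < p1 (-1) →
        ((∃ s, IsStationaryDist (queueMatrix N p0 p1) s) ↔ QueueStable N p1)) ∧
      -- the steady state of a stable queue
      (QueueStable N p1 →
        (∃! s, IsStationaryDist (queueMatrix N p0 p1) s) ∧
        ∀ s, IsStationaryDist (queueMatrix N p0 p1) s →
          s 0 = (p1 (-1) - meanUp N p1) / (p1 (-1) - meanUp N p1 + emptyArrivalRate N p0) ∧
          s 0 = (1 + deriv (transB N p1) 1)
            / (1 + deriv (transB N p1) 1 - deriv (transA N p0) 1) ∧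
          ∃ Qbar : ℝ,
            HasSum (fun i : ℕ => (i : ℝ) * s i) Qbar ∧
            HasDerivAt (transS s) (-Qbar) 1 ∧
            iteratedDeriv 2 (transL N p1) 1 ≠ 0 ∧
            Qbar = -(s 0 * (iteratedDeriv 2 (transK N p0 p1) 1
              / iteratedDeriv 2 (transL N p1) 1)) ∧
            Qbar =
              ((meanUp N p1 - p1 (-1)) * ∑ k ∈ Finset.Icc 1 N, (k : ℝ) * ((k : ℝ) + 3) * p0 k
                + emptyArrivalRate N p0
                  * (2 * p1 (-1) - ∑ k ∈ Finset.Icc 1 N, (k : ℝ) * ((k : ℝ) + 3) * p1 (k : ℤ)))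
              / (2 * (meanUp N p1 - p1 (-1))
                * (p1 (-1) - meanUp N p1 + emptyArrivalRate N p0)))) ∧
    -- the increment laws of the relay network are such laws, and its queue is stable exactly when
    -- the arrival rate at the non-empty queue is smaller than the service rate
    (∀ net : RelayNetwork,
      IsIncrementLaw net.N net.p0 net.p1 ∧
      emptyArrivalRate net.N net.p0 = net.lam0 ∧
      (QueueStable net.N net.p1 ↔ net.lam1 < net.mu)) := by
  refine ⟨fun N p0 p1 h => ⟨⟨queueMatrix_nonneg h, hasSum_queueMatrix_col h,
    queueMatrix_eq_zero⟩, fun hlam hp => ⟨fun ⟨s, hs⟩ => hs.queueStable h hlam hp,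
      fun hst => hst.exists_isStationaryDist h⟩,
    fun hst => ⟨hst.existsUnique_isStationaryDist h, fun s hs => queue_steady_state h hst hs⟩⟩,
    fun net => ⟨net.isIncrementLaw, rfl, net.queueStable_iff⟩⟩
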